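/- Let $(\mathcal E,\star)$ be a group and let $E\subset\mathcal E$ be a countable subset closed under $\star$ and containing the identity $e$. Let $(X(t))$ be a substochastic Markov chain on $E$ with transition probabilities $p(x,y)$, $x,y\in E$, completed by an absorbing state $\vartheta\notin E$ with $p(x,\vartheta)=1-\sum_{y\in E}p(x,y)$. Put $\tau_\vartheta=\inf\{t\ge 1: X(t)=\vartheta\}$, $G(x,y)=\sum_{t\ge0}\mathbb P_x(X(t)=y)$ and $Q(x,y)=\mathbb P_x(X(t)=y\text{ for some }0<t<\infty)$. Assume that 1. $(X(t))$ is irreducible and transient on $E$; 2. $p(x\star u,y\star u)\ge p(x,y)$ for all $x,y,u\in E$; 3. the hitting probabilities are slowly varying along every $u\in E$: for every $u \in E$, uniformly in $x\in E$, $$\lim_{n\to\infty}\tfrac1n\log Q(x,x\star u^{\star n})=\lim_{n\to\infty}\tfrac1n\log Q(x\star u^{\star n},x)=0 .$$ For $u,x,y\in E$ let $a_u(x,y)=p(x\star u,y)-p(x,y\star u^{-1})$ if $y\in E\star u$ and $a_u(x,y)=p(x\star u,y)$ otherwise, and let $p_H(x,y)=\sum_{z\in E}G(e,z)\,a_x(z,y)$.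 The matrix $p_H$ is non-negative and substochastic; the ladder height process $(H_n)$ is the Markov chain with transition matrix $p_H$, completed by the absorbing state $\vartheta$ in the same way. Let $\mathcal T_\vartheta=\inf\{n\ge0:H_n=\vartheta\}$ and $V(x)=\mathbb E_x(\mathcal T_\vartheta)$. A function $h:E\to[0,\infty)$, not identically zero, is called harmonic (superharmonic) for a chain with transition matrix $q$ if $\sum_y q(x,y)h(y)=h(x)$ (respectively $\le h(x)$) for all $x\in E$; put $h(\vartheta)=0$. Then every harmonic function $h$ of $(X(t))$ is superharmonic for $(H_n)$, and $$h(x)=h(e)V(x)+\tilde h(x),\qquad x\in E,$$ where $V$ is finite, and where the limit $$\tilde h(x)=\lim_{n\to\infty}\mathbb E_x\bigl(h(H_n);\,\mathcal T_\vartheta>n\bigr),\qquad x\in E,$$ exists, is finite and non-negative, and satisfies $\sum_{y\in E}p_H(x,y)\tilde h(y)=\tilde h(x)$ for all $x\in E$. If moreover $\mathbb E_x(\tau_\vartheta)=+\infty$ for all $x\in E$, then for every harmonic function $h$ of $(X(t))$ the function $\tilde h$ is identically zero and $h$ is proportional to $V$. Otherwise, for every harmonic function $h$ of $(X(t))$,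 the function $\tilde h$ is not identically zero. -/

import Mathlib

open MeasureTheory ProbabilityTheory Filter Topology
open scoped ENNReal NNReal

noncomputable section

namespace LadderWalk

/-! ### Substochastic Markov chains on a set `S`, with a cemetery

The state space with the absorbing state added is `Option S`; the cemetery `ϑ` is `none`.
It carries the discrete σ-algebra. -/

instance optionMeasurableSpace (S : Type*) : MeasurableSpace (Option S) := ⊤

instance optionDiscrete (S : Type*) : DiscreteMeasurableSpace (Option S) := ⟨fun _ => trivial⟩

theorem tsum_option_eq {S : Type*} (f : Option S → ℝ≥0∞) :
    ∑' o, f o = f none + ∑' x, f (some x) := by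
  refine (ENNReal.tsum_eq_add_tsum_ite none).trans ?_
  congr 1
  refine ((Option.some_injective S).tsum_eq ?_).symm.trans ?_
  · intro o ho
    cases o with
    | none => simp at ho
    | some x => exact ⟨x, rfl⟩
  · simp

/-- The matrix `q` (with entries in `[0, ∞]`) is substochastic. -/
def Substochastic {S : Type*} (q : S → S → ℝ≥0∞) : Prop := ∀ x, ∑' y, q x y ≤ 1

/-- The distribution of the next state: from `x ∈ S` the chain goes to `y ∈ S` with probability
`q x y` and to the cemetery with the remaining probability; the cemetery is absorbing. -/
def step {S : Type*} (q : S → S → ℝ≥0∞) (hq : Substochastic q) : Option S → PMF (Option S)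
  | none => PMF.pure none
  | some x => ⟨fun o => o.elim (1 - ∑' y, q x y) (q x), by
      have h : (∑' o : Option S, o.elim (1 - ∑' y, q x y) (q x)) = 1 := by
        rw [tsum_option_eq]
        exact tsub_add_cancel_of_le (hq x)
      have h2 : HasSum (fun o : Option S => o.elim (1 - ∑' y, q x y) (q x))
          (∑' o : Option S, o.elim (1 - ∑' y, q x y) (q x)) := ENNReal.summable.hasSum
      rwa [h] at h2⟩

/-- The transition kernel on `Option S`. -/
def stepKernel {S : Type*} (q : S → S → ℝ≥0∞) (hq : Substochastic q) :
    Kernel (Option S) (Option S) where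
  toFun o := (step q hq o).toMeasure
  measurable' := Measurable.of_discrete

instance stepKernel_markov {S : Type*} (q : S → S → ℝ≥0∞) (hq : Substochastic q) :
    IsMarkovKernel (stepKernel q hq) :=
  ⟨fun o => PMF.toMeasure.isProbabilityMeasure (step q hq o)⟩

/-- The transition kernel as a function of the whole past: only the present state matters. -/
def pastKernel {S : Type*} (q : S → S → ℝ≥0∞) (hq : Substochastic q) (n : ℕ) :
    Kernel ((i : Finset.Iic n) → Option S) (Option S) :=
  (stepKernel q hq).comap (fun ω => ω ⟨n, Finset.mem_Iic.2 le_rfl⟩) (measurable_pi_apply _)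

instance pastKernel_markov {S : Type*} (q : S → S → ℝ≥0∞) (hq : Substochastic q) (n : ℕ) :
    IsMarkovKernel (pastKernel q hq n) := by
  unfold pastKernel; infer_instance

/-- `ℙ_x`: the law, on the space of trajectories `ℕ → Option S`, of the Markov chain with
transition matrix `q` started at `x ∈ S`. -/
def pathLaw {S : Type*} (q : S → S → ℝ≥0∞) (hq : Substochastic q) (x : S) :
    Measure (ℕ → Option S) :=
  Kernel.traj (X := fun _ => Option S) (pastKernel q hq) 0 (fun _ => some x)

instance pathLaw_prob {S : Type*} (q : S → S → ℝ≥0∞) (hq : Substochastic q) (x : S) :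
    IsProbabilityMeasure (pathLaw q hq x) := by
  unfold pathLaw; infer_instance

/-- `ℙ_x(X(t) = y)`. -/
def transProb {S : Type*} (q : S → S → ℝ≥0∞) (hq : Substochastic q) (t : ℕ) (x y : S) : ℝ≥0∞ :=
  pathLaw q hq x {ω | ω t = some y}

/-- The Green function `G(x, y) = ∑_t ℙ_x(X(t) = y)`. -/
def green {S : Type*} (q : S → S → ℝ≥0∞) (hq : Substochastic q) (x y : S) : ℝ≥0∞ :=
  ∑' t, transProb q hq t x y

/-- The hitting probability `Q(x, y) = ℙ_x(X(t) = y for some 0 < t < ∞)`. -/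
def hitProb {S : Type*} (q : S → S → ℝ≥0∞) (hq : Substochastic q) (x y : S) : ℝ≥0∞ :=
  pathLaw q hq x {ω | ∃ t, 0 < t ∧ ω t = some y}

/-- `inf {n ≥ m : ω n = ϑ}`, with value `∞` if there is no such `n`. -/
def absorptionTime {S : Type*} (m : ℕ) (ω : ℕ → Option S) : ℕ∞ :=
  ⨅ (n : ℕ) (_ : m ≤ n ∧ ω n = none), (n : ℕ∞)

/-- `𝔼_x(inf {n ≥ m : X(n) = ϑ})`. -/
def meanAbsorptionTime {S : Type*} (q : S → S → ℝ≥0∞) (hq : Substochastic q) (m : ℕ) (x : S) :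
    ℝ≥0∞ :=
  ∫⁻ ω, ((absorptionTime m ω : ℕ∞) : ℝ≥0∞) ∂(pathLaw q hq x)

/-- Extension of a function to the cemetery by `0`. -/
def extendZero {S : Type*} (f : S → ℝ≥0) (o : Option S) : ℝ≥0∞ :=
  o.elim 0 (fun y => (f y : ℝ≥0∞))

/-- `𝔼_x(f(X(n)); T > n)`, where `T = inf {k ≥ 0 : X(k) = ϑ}`. -/
def killedMean {S : Type*} (q : S → S → ℝ≥0∞) (hq : Substochastic q) (f : S → ℝ≥0) (n : ℕ)
    (x : S) : ℝ≥0∞ :=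
  ∫⁻ ω in {ω | (n : ℕ∞) < absorptionTime 0 ω}, extendZero f (ω n) ∂(pathLaw q hq x)

/-- From every `x`, every `y` is reached at some time `t ≥ 0` with positive probability. -/
def IsIrreducibleChain {S : Type*} (q : S → S → ℝ≥0∞) (hq : Substochastic q) : Prop :=
  ∀ x y, ∃ t, 0 < transProb q hq t x y

/-- The Green function is finite. -/
def IsTransientChain {S : Type*} (q : S → S → ℝ≥0∞) (hq : Substochastic q) : Prop :=
  ∀ x y, green q hq x y < ∞

/-- `q f (x) = ∑_y q(x, y) f(y)`. -/
def applyMatrix {S : Type*} (q : S → S → ℝ≥0∞) (f : S → ℝ≥0) (x : S) : ℝ≥0∞ :=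
  ∑' y, q x y * (f y : ℝ≥0∞)

/-- A harmonic function: non-negative, finite, not identically zero, and `q f = f`. -/
def IsHarmonic {S : Type*} (q : S → S → ℝ≥0∞) (f : S → ℝ≥0) : Prop :=
  f ≠ 0 ∧ ∀ x, applyMatrix q f x = f x

/-- A superharmonic function: non-negative, finite, not identically zero, and `q f ≤ f`. -/
def IsSuperharmonic {S : Type*} (q : S → S → ℝ≥0∞) (f : S → ℝ≥0) : Prop :=
  f ≠ 0 ∧ ∀ x, applyMatrix q f x ≤ f x

/-! ### One-step recursion for `ℙ_x(X(t) = y)` -/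

theorem step_some {S : Type*} (q : S → S → ℝ≥0∞) (hq : Substochastic q) (x y : S) :
    step q hq (some x) (some y) = q x y := rfl

theorem step_none {S : Type*} (q : S → S → ℝ≥0∞) (hq : Substochastic q) (y : S) :
    step q hq none (some y) = 0 := by
  simp [step]

theorem transProb_zero {S : Type*} [DecidableEq S] (q : S → S → ℝ≥0∞) (hq : Substochastic q)
    (x y : S) : transProb q hq 0 x y = if x = y then 1 else 0 := by
  have h := Kernel.traj_map_frestrictLe_apply (X := fun _ => Option S)
    (κ := pastKernel q hq) 0 0
    (fun _ => some x)
  rw [Kernel.partialTraj_self, Kernel.id_apply] at h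
  have hms : MeasurableSet {v : (i : Finset.Iic 0) → Option S |
      v ⟨0, Finset.mem_Iic.2 le_rfl⟩ = some y} :=
    (measurable_pi_apply (X := fun _ : Finset.Iic 0 => Option S)
      (⟨0, Finset.mem_Iic.2 le_rfl⟩ : Finset.Iic 0))
      (MeasurableSet.of_discrete (s := ({some y} : Set (Option S))))
  have h2 := congrArg (fun μ => μ {v : (i : Finset.Iic 0) → Option S |
      v ⟨0, Finset.mem_Iic.2 le_rfl⟩ = some y}) h
  rw [Measure.map_apply (Preorder.measurable_frestrictLe 0) hms, Measure.dirac_apply' _ hms] at h2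
  rw [transProb, pathLaw]
  refine h2.trans ?_
  by_cases hxy : x = y <;> simp [hxy]

theorem transProb_succ {S : Type*} [Countable S] (q : S → S → ℝ≥0∞) (hq : Substochastic q)
    (t : ℕ) (x y : S) :
    transProb q hq (t + 1) x y = ∑' z, transProb q hq t x z * q z y := by
  have hy : MeasurableSet ({some y} : Set (Option S)) := MeasurableSet.of_discrete
  have h := Kernel.partialTraj_compProd_eq_map_traj (X := fun _ => Option S)
    (κ := pastKernel q hq) (Nat.zero_le t)
    (x₀ := fun _ => some x)
  have h2 := congrArg (fun μ => μ (Set.univ ×ˢ ({some y} : Set (Option S)))) h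
  rw [Measure.map_apply (by fun_prop) (MeasurableSet.univ.prod hy),
    Measure.compProd_apply_prod MeasurableSet.univ hy,
    ← Kernel.traj_map_frestrictLe_apply, Measure.restrict_univ,
    lintegral_map (Kernel.measurable_coe _ hy) (Preorder.measurable_frestrictLe t)] at h2
  have h3 : transProb q hq (t + 1) x y
      = ∫⁻ ω, (step q hq (ω t)) (some y) ∂(pathLaw q hq x) := by
    rw [transProb]
    refine Eq.trans ?_ (h2.symm.trans ?_)
    · rw [pathLaw]; congr 1; ext ω; simp
    · refine lintegral_congr fun ω => ?_
      exact PMF.toMeasure_apply_singleton _ _ hy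
  rw [h3, ← lintegral_map (μ := pathLaw q hq x) (f := fun o => (step q hq o) (some y))
    (g := fun ω : ℕ → Option S => ω t) Measurable.of_discrete (measurable_pi_apply t),
    lintegral_countable', tsum_option_eq]
  simp only [step_none, zero_mul, zero_add, step_some]
  refine tsum_congr fun z => ?_
  rw [Measure.map_apply (measurable_pi_apply t) MeasurableSet.of_discrete, mul_comm]
  rfl

/-! ### Random walks on a sub-semigroup with identity of a group -/

/-- Translation inequality `p(x ⋆ u, y ⋆ u) ≥ p(x, y)`. -/
def TranslationMonotone {𝓔 : Type*} [Group 𝓔] {E : Submonoid 𝓔} (p : E → E → ℝ≥0∞) : Prop :=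
  ∀ x y u : E, p x y ≤ p (x * u) (y * u)

open Classical in
/-- The matrix `a_u(x, y)`: `p(x ⋆ u, y) - p(x, y ⋆ u⁻¹)` if `y ∈ E ⋆ u`, that is, if
`y ⋆ u⁻¹ ∈ E`, and `p(x ⋆ u, y)` otherwise. -/
def excessMatrix {𝓔 : Type*} [Group 𝓔] {E : Submonoid 𝓔} (p : E → E → ℝ≥0∞) (u x y : E) :
    ℝ≥0∞ :=
  if h : (y : 𝓔) * (u : 𝓔)⁻¹ ∈ E then p (x * u) y - p x ⟨(y : 𝓔) * (u : 𝓔)⁻¹, h⟩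
  else p (x * u) y

/-- The transition matrix of the ladder height process,
`p_H(x, y) = ∑_z G(e, z) a_x(z, y)`. -/
def ladderMatrix {𝓔 : Type*} [Group 𝓔] {E : Submonoid 𝓔} (p : E → E → ℝ≥0∞)
    (hp : Substochastic p) (x y : E) : ℝ≥0∞ :=
  ∑' z, green p hp 1 z * excessMatrix p x z y

theorem tsum_excessMatrix_add {𝓔 : Type*} [Group 𝓔] {E : Submonoid 𝓔} (p : E → E → ℝ≥0∞)
    (hB : TranslationMonotone p) (u x : E) :
    ∑' y, excessMatrix p u x y + ∑' y, p x y = ∑' y, p (x * u) y := by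
  classical
  have hinj : Function.Injective (fun y : E => y * u) := fun a b h => by simpa using h
  have h1 : ∑' y, p x y
      = ∑' y : E, if h : (y : 𝓔) * (u : 𝓔)⁻¹ ∈ E then p x ⟨(y : 𝓔) * (u : 𝓔)⁻¹, h⟩ else 0 := by
    rw [← hinj.tsum_eq (f := fun y : E =>
      if h : (y : 𝓔) * (u : 𝓔)⁻¹ ∈ E then p x ⟨(y : 𝓔) * (u : 𝓔)⁻¹, h⟩ else 0)]
    · refine tsum_congr fun y => ?_
      simp
    · intro y hy
      by_cases h : (y : 𝓔) * (u : 𝓔)⁻¹ ∈ E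
      · exact ⟨⟨_, h⟩, by ext; simp⟩
      · simp [h] at hy
  rw [h1, ← ENNReal.tsum_add]
  refine tsum_congr fun y => ?_
  rw [excessMatrix]
  split_ifs with h
  · refine tsub_add_cancel_of_le ?_
    have h2 := hB x ⟨(y : 𝓔) * (u : 𝓔)⁻¹, h⟩ u
    have h3 : (⟨(y : 𝓔) * (u : 𝓔)⁻¹, h⟩ : E) * u = y := by ext; simp
    rwa [h3] at h2
  · simp

/-- The matrix of the ladder height process is substochastic. -/
theorem ladderMatrix_substochastic {𝓔 : Type*} [Group 𝓔] {E : Submonoid 𝓔} [Countable E]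
    (p : E → E → ℝ≥0∞) (hp : Substochastic p) (hB : TranslationMonotone p) :
    Substochastic (ladderMatrix p hp) := by
  classical
  intro x
  have hA : ∀ z, ∑' y, excessMatrix p x z y + ∑' y, p z y ≤ 1 := fun z =>
    (tsum_excessMatrix_add p hB x z).trans_le (hp _)
  have hsucc : ∀ t, ∑' y, transProb p hp (t + 1) 1 y
      = ∑' z, transProb p hp t 1 z * ∑' y, p z y := by
    intro t
    simp_rw [transProb_succ, ← ENNReal.tsum_mul_left]
    exact ENNReal.tsum_comm
  have hfin : ∀ n, ∑ t ∈ Finset.range n, ∑' z, transProb p hp t 1 z * ∑' y, excessMatrix p x z y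
      + ∑' z, transProb p hp n 1 z ≤ 1 := by
    intro n
    induction n with
    | zero => simp [transProb_zero]
    | succ n ih =>
      refine le_trans ?_ ih
      rw [Finset.sum_range_succ, hsucc, add_assoc, ← ENNReal.tsum_add]
      gcongr with z
      rw [← mul_add]
      exact mul_le_of_le_one_right' (hA z)
  calc ∑' y, ladderMatrix p hp x y
      = ∑' t, ∑' z, transProb p hp t 1 z * ∑' y, excessMatrix p x z y := by
        simp_rw [ladderMatrix, green]
        rw [ENNReal.tsum_comm, ENNReal.tsum_comm (f := fun t z => transProb p hp t 1 z * ∑' y, excessMatrix p x z y)]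
        refine tsum_congr fun z => ?_
        rw [ENNReal.tsum_mul_left, ENNReal.tsum_mul_right]
    _ ≤ 1 := by
        rw [ENNReal.tsum_eq_iSup_nat]
        exact iSup_le fun n => le_self_add.trans (hfin n)

/-- The hitting probabilities are slowly varying along `u`: uniformly in `x ∈ E`, both
`n⁻¹ log Q(x, x ⋆ uⁿ)` and `n⁻¹ log Q(x ⋆ uⁿ, x)` tend to `0`. The first clause makes the
logarithms finite for large `n`. -/
def SlowlyVaryingAlong {𝓔 : Type*} [Group 𝓔] {E : Submonoid 𝓔} (p : E → E → ℝ≥0∞)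
    (hp : Substochastic p) (u : E) : Prop :=
  (∀ᶠ n : ℕ in atTop, ∀ x : E,
      0 < hitProb p hp x (x * u ^ n) ∧ 0 < hitProb p hp (x * u ^ n) x) ∧
  TendstoUniformly
    (fun (n : ℕ) (x : E) => 1 / (n : ℝ) * Real.log (hitProb p hp x (x * u ^ n)).toReal)
    (fun _ => 0) atTop ∧
  TendstoUniformly
    (fun (n : ℕ) (x : E) => 1 / (n : ℝ) * Real.log (hitProb p hp (x * u ^ n) x).toReal)
    (fun _ => 0) atTop

/-- `𝔼_x(τ_ϑ)`, where `τ_ϑ = inf {t ≥ 1 : X(t) = ϑ}`. -/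
def meanExitTime {𝓔 : Type*} [Group 𝓔] {E : Submonoid 𝓔} (p : E → E → ℝ≥0∞)
    (hp : Substochastic p) (x : E) : ℝ≥0∞ :=
  meanAbsorptionTime p hp 1 x

/-- The renewal function `V(x) = 𝔼_x(𝒯_ϑ)`, where `𝒯_ϑ = inf {n ≥ 0 : H_n = ϑ}`. -/
def renewalFunction {𝓔 : Type*} [Group 𝓔] {E : Submonoid 𝓔} [Countable E] (p : E → E → ℝ≥0∞)
    (hp : Substochastic p) (hB : TranslationMonotone p) (x : E) : ℝ≥0∞ :=
  meanAbsorptionTime (ladderMatrix p hp) (ladderMatrix_substochastic p hp hB) 0 x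

end LadderWalk

end

/-! Write `e` for the identity. If `f` is harmonic, monotonicity under translation makes `x ↦ f(x ⋆
u)` superharmonic with defect `a_u f`. Its Riesz decomposition at `e` reads `f(u) = p_H f(u) + T_u
f(e)`: the potential `G(a_u f)(e)` is `p_H f(u)` by definition of `p_H`, and `T_u f` is the greatest
harmonic minorant of the translate.

The crux is `T_u f = f` (`transHarm_eq_self`). On the cone of harmonic functions `T_u` is additive,
positively homogeneous and satisfies `T_u² = T_{u²}`. Since `Q(x, y) f(y) ≤ f(x)`, slow variation
gives `b^{-n} ≤ T_{u^n} ≤ b^n` for every `b > 1` and large `n`. Square roots can be extracted from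
such bounds because `c - T_u` preserves the cone whenever `T_u ≤ c` (`le_of_sq_le`, `le_of_le_sq`).
Taking `n = 2^m` yields `b⁻¹ ≤ T_u ≤ b`, and `b ↓ 1`.

Hence `h = h(e) + p_H h`, and the Riesz decomposition for `p_H` is `h = h(e) V + h̃` with `h̃ = lim
p_H^n h`.

If the mean exit time is infinite, the truncated means `W_n`, normalised at `e`, are dominated by
`V` and have a harmonic limit point, which must be `V` (`renewal_harmonic`). Then `h̃ = h - h(e) V`
is harmonic and vanishes at `e`, so it is zero by irreducibility. If the mean exit time `W` is
finite somewhere, it is finite at `e`, where `p^n W → 0`; as `V ≤ W`, the equality `h = h(e) V`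
would force `h(e) ≤ h(e) p^n W(e) → 0`. -/

namespace LadderWalk

/-! ### Non-negative matrices acting on functions -/

/-- The action `f ↦ ∑_y q(·, y) f(y)` of a matrix on functions with values in `[0, ∞]`. -/
noncomputable def act {S : Type*} (q : S → S → ℝ≥0∞) (f : S → ℝ≥0∞) (x : S) : ℝ≥0∞ :=
  ∑' y, q x y * f y

section Act

variable {S : Type*} {q : S → S → ℝ≥0∞}

theorem act_mono {f g : S → ℝ≥0∞} (h : f ≤ g) : act q f ≤ act q g :=
  fun x => ENNReal.tsum_le_tsum fun y => mul_le_mul_right (h y) (q x y)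

theorem act_add (f g : S → ℝ≥0∞) : act q (f + g) = act q f + act q g := by
  funext x
  simp only [act, Pi.add_apply, mul_add]
  exact ENNReal.tsum_add

theorem act_smul (c : ℝ≥0∞) (f : S → ℝ≥0∞) :
    act q (fun y => c * f y) = fun x => c * act q f x := by
  funext x
  simp only [act, ← ENNReal.tsum_mul_left]
  exact tsum_congr fun y => by ring

theorem act_iterate_mono {f g : S → ℝ≥0∞} (h : f ≤ g) (n : ℕ) :
    (act q)^[n] f ≤ (act q)^[n] g := by
  induction n with
  | zero => exact h
  | succ n ih => simp only [Function.iterate_succ_apply']; exact act_mono ih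

theorem act_iterate_add (f g : S → ℝ≥0∞) (n : ℕ) :
    (act q)^[n] (f + g) = (act q)^[n] f + (act q)^[n] g := by
  induction n with
  | zero => rfl
  | succ n ih => simp only [Function.iterate_succ_apply', ih, act_add]

theorem act_iterate_smul (c : ℝ≥0∞) (f : S → ℝ≥0∞) (n : ℕ) :
    (act q)^[n] (fun y => c * f y) = fun x => c * (act q)^[n] f x := by
  induction n with
  | zero => rfl
  | succ n ih => simp only [Function.iterate_succ_apply', ih, act_smul]

theorem act_sum {ι : Type*} (s : Finset ι) (f : ι → S → ℝ≥0∞) :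
    act q (fun y => ∑ i ∈ s, f i y) = fun x => ∑ i ∈ s, act q (f i) x := by
  funext x
  simp only [act, Finset.mul_sum]
  exact Summable.tsum_finsetSum fun i _ => ENNReal.summable

theorem act_tsum (f : ℕ → S → ℝ≥0∞) :
    act q (fun y => ∑' n, f n y) = fun x => ∑' n, act q (f n) x := by
  funext x
  simp only [act, ← ENNReal.tsum_mul_left]
  exact ENNReal.tsum_comm

/-- Monotone convergence for decreasing sequences. -/
theorem act_iInf (hq : Substochastic q) {f : ℕ → S → ℝ≥0∞} (hf : Antitone f) {x : S}
    (hfin : act q (f 0) x ≠ ∞) : act q (fun y => ⨅ n, f n y) x = ⨅ n, act q (f n) x := by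
  let _ : MeasurableSpace S := ⊤
  have hq' : ∀ y, q x y ≠ ∞ := fun y =>
    ne_top_of_le_ne_top ENNReal.one_ne_top ((ENNReal.le_tsum y).trans (hq x))
  have h := lintegral_iInf (μ := Measure.count) (f := fun n y => q x y * f n y)
    (fun n => Measurable.of_discrete)
    (fun m n hmn y => mul_le_mul_right (hf hmn y) (q x y))
    (by rwa [lintegral_count])
  simp only [lintegral_count] at h
  simp only [act]
  rw [← h]
  exact tsum_congr fun y => ENNReal.mul_iInf fun h => absurd h (hq' y)

theorem act_one_le (hq : Substochastic q) : act q 1 ≤ 1 := fun x => by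
  simpa [act] using hq x

/-- Carrying the defect as a summand `d`, rather than as `g - q g`, removes any need for finiteness.
-/
theorem riesz_partial {g d : S → ℝ≥0∞} (hg : g = d + act q g) (n : ℕ) (x : S) :
    g x = ∑ k ∈ Finset.range n, (act q)^[k] d x + (act q)^[n] g x := by
  induction n with
  | zero => simp
  | succ n ih =>
    rw [ih, Finset.sum_range_succ, add_assoc]
    congr 1
    conv_lhs => rw [hg]
    rw [act_iterate_add, Function.iterate_succ_apply, Pi.add_apply]

theorem iterate_antitone {g : S → ℝ≥0∞} (hg : act q g ≤ g) : Antitone fun n => (act q)^[n] g :=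
  antitone_nat_of_succ_le fun n => by
    rw [Function.iterate_succ_apply]
    exact act_iterate_mono hg n

theorem act_le_of_eq_add {g d : S → ℝ≥0∞} (hg : g = d + act q g) : act q g ≤ g := by
  conv_rhs => rw [hg]
  exact fun x => le_add_self

theorem tsum_iterate_eq (d : S → ℝ≥0∞) :
    (fun x => ∑' k, (act q)^[k] d x) = d + act q fun x => ∑' k, (act q)^[k] d x := by
  funext x
  rw [act_tsum, Pi.add_apply, tsum_eq_zero_add' ENNReal.summable]
  simp only [Function.iterate_succ_apply']
  rfl

/-- Riesz decomposition of a function `g` with `g = d + q g` into a potential and a limit. -/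
theorem riesz {g d : S → ℝ≥0∞} (hg : g = d + act q g) (x : S) :
    g x = ∑' k, (act q)^[k] d x + ⨅ n, (act q)^[n] g x := by
  have hle := act_le_of_eq_add hg
  have h1 := ENNReal.tendsto_nat_tsum fun k => (act q)^[k] d x
  have h2 := tendsto_atTop_iInf (f := fun n => (act q)^[n] g x)
    fun m n hmn => iterate_antitone hle hmn x
  refine tendsto_nhds_unique (tendsto_const_nhds (f := atTop (α := ℕ))) ((h1.add h2).congr ?_)
  exact fun n => (riesz_partial hg n x).symm

/-- Applying `q` only shifts the decreasing sequence of iterates; finiteness of `g` lets the infimum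
pass through the sum. -/
theorem act_iInf_iterate (hq : Substochastic q) {g : S → ℝ≥0∞} (hg : act q g ≤ g)
    (hfin : ∀ x, g x ≠ ∞) :
    act q (fun x => ⨅ n, (act q)^[n] g x) = fun x => ⨅ n, (act q)^[n] g x := by
  funext x
  rw [act_iInf hq (iterate_antitone hg) (ne_top_of_le_ne_top (hfin x) (hg x))]
  refine le_antisymm (le_iInf fun n => (iInf_le _ n).trans ?_) (le_iInf fun n => ?_)
  · rw [← Function.iterate_succ_apply' (act q)]
    exact iterate_antitone hg (Nat.le_succ n) x
  · rw [← Function.iterate_succ_apply' (act q)]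
    exact iInf_le _ (n + 1)

theorem iterate_eq_self {f : S → ℝ≥0∞} (hf : act q f = f) (n : ℕ) : (act q)^[n] f = f :=
  Function.iterate_fixed hf n

theorem tsum_transProb_mul [Countable S] (hq : Substochastic q) (t : ℕ) (f : S → ℝ≥0∞) (x : S) :
    ∑' y, transProb q hq t x y * f y = (act q)^[t] f x := by
  classical
  induction t generalizing f with
  | zero =>
    rw [tsum_eq_single x]
    · simp [transProb_zero]
    · intro y hy; simp [transProb_zero, hy.symm]
  | succ t ih =>
    rw [Function.iterate_succ_apply, ← ih]
    simp_rw [transProb_succ, act, ← ENNReal.tsum_mul_left, ← ENNReal.tsum_mul_right]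
    rw [ENNReal.tsum_comm]
    exact tsum_congr fun z => tsum_congr fun y => by ring

theorem transProb_mul_le [Countable S] (hq : Substochastic q) {f : S → ℝ≥0∞} (hf : act q f ≤ f)
    (t : ℕ) (x y : S) : transProb q hq t x y * f y ≤ f x :=
  (ENNReal.le_tsum (f := fun y => transProb q hq t x y * f y) y).trans
    ((tsum_transProb_mul hq t f x).le.trans (iterate_antitone hf (Nat.zero_le t) x))

end Act

/-! ### Path space -/

theorem measurableSet_eval {S ι : Type*} (i : ι) (P : Option S → Prop) :
    MeasurableSet {v : ι → Option S | P (v i)} :=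
  (measurable_pi_apply (X := fun _ : ι => Option S) i) (MeasurableSet.of_discrete (s := {o | P o}))

section Paths

variable {S : Type*} [Countable S] {q : S → S → ℝ≥0∞}

/-- Markov property at time `t`: the past up to time `t` and one further step. -/
theorem pathLaw_inter_succ (hq : Substochastic q) (t : ℕ) (x y : S)
    {B : Set ((i : Finset.Iic t) → Option S)} (hB : MeasurableSet B) :
    pathLaw q hq x (Preorder.frestrictLe t ⁻¹' B ∩ {ω | ω (t + 1) = some y})
      = ∑' z, pathLaw q hq x (Preorder.frestrictLe t ⁻¹' B ∩ {ω | ω t = some z}) * q z y := by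
  have hy : MeasurableSet ({some y} : Set (Option S)) := MeasurableSet.of_discrete
  have h := Kernel.partialTraj_compProd_eq_map_traj (X := fun _ => Option S)
    (κ := pastKernel q hq) (Nat.zero_le t)
    (x₀ := fun _ => some x)
  have h2 := congrArg (fun μ => μ (B ×ˢ ({some y} : Set (Option S)))) h
  rw [Measure.map_apply (by fun_prop) (hB.prod hy),
    Measure.compProd_apply_prod hB hy,
    ← Kernel.traj_map_frestrictLe_apply,
    setLIntegral_map hB (Kernel.measurable_coe _ hy) (Preorder.measurable_frestrictLe t)] at h2
  have hB' : MeasurableSet (Preorder.frestrictLe (π := fun _ => Option S) t ⁻¹' B) :=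
    Preorder.measurable_frestrictLe t hB
  have h3 : pathLaw q hq x (Preorder.frestrictLe t ⁻¹' B ∩ {ω | ω (t + 1) = some y})
      = ∫⁻ ω in Preorder.frestrictLe t ⁻¹' B, (step q hq (ω t)) (some y) ∂(pathLaw q hq x) := by
    refine Eq.trans ?_ (h2.symm.trans ?_)
    · rw [pathLaw]; congr 1
    · refine lintegral_congr fun ω => ?_
      exact PMF.toMeasure_apply_singleton _ _ hy
  rw [h3, ← lintegral_map (μ := (pathLaw q hq x).restrict _) (f := fun o => (step q hq o) (some y))
    (g := fun ω : ℕ → Option S => ω t) Measurable.of_discrete (measurable_pi_apply t),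
    lintegral_countable', tsum_option_eq]
  simp only [step_none, zero_mul, zero_add, step_some]
  refine tsum_congr fun z => ?_
  rw [Measure.map_apply (measurable_pi_apply t) MeasurableSet.of_discrete,
    Measure.restrict_apply (measurable_pi_apply t MeasurableSet.of_discrete), mul_comm,
    Set.inter_comm]
  rfl

/-- No visit to `y` at the times `1, …, t`. -/
def avoids (y : S) (t : ℕ) : Set ((i : Finset.Iic t) → Option S) :=
  {v | ∀ i : Finset.Iic t, 0 < (i : ℕ) → v i ≠ some y}

omit [Countable S] in
theorem measurableSet_avoids (y : S) (t : ℕ) : MeasurableSet (avoids y t) := by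
  have : avoids y t = ⋂ (i : Finset.Iic t), ⋂ (_ : 0 < (i : ℕ)), {v | v i ≠ some y} := by
    ext v; simp [avoids]
  rw [this]
  exact MeasurableSet.iInter fun i => MeasurableSet.iInter fun _ =>
    measurableSet_eval i fun o => o ≠ some y

/-- Superharmonic functions dominate their value at `y` times the probability to hit `y`. -/
theorem hitProb_mul_le (hq : Substochastic q) {f : S → ℝ≥0∞} (hf : act q f ≤ f) (x y : S) :
    hitProb q hq x y * f y ≤ f x := by
  classical
  set A : ℕ → Set (ℕ → Option S) := fun t => Preorder.frestrictLe t ⁻¹' avoids y t with hA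
  have hAmem : ∀ t ω, ω ∈ A t ↔ ∀ k, 0 < k → k ≤ t → ω k ≠ some y := by
    intro t ω
    simp only [hA, avoids, Set.mem_preimage, Set.mem_ofPred_eq]
    exact ⟨fun h k hk hkt => h ⟨k, Finset.mem_Iic.2 hkt⟩ hk,
      fun h i hi => h i hi (Finset.mem_Iic.1 i.2)⟩
  -- Optional stopping at the first visit to `y` at a positive time: `c t` is the probability that
  -- this visit occurs at time `t + 1`, and `r t` is the law at time `t` on paths that have not yet
  -- made it.
  set c : ℕ → ℝ≥0∞ := fun t => pathLaw q hq x (A t ∩ {ω | ω (t + 1) = some y}) with hc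
  set r : ℕ → S → ℝ≥0∞ := fun t z => pathLaw q hq x (A t ∩ {ω | ω t = some z}) with hr
  have hstep : ∀ t, ∑' z, r (t + 1) z * f z + c t * f y ≤ ∑' z, r t z * f z := by
    intro t
    calc ∑' z, r (t + 1) z * f z + c t * f y
        ≤ ∑' w, pathLaw q hq x (A t ∩ {ω | ω (t + 1) = some w}) * f w := by
          rw [← tsum_ite_eq y (fun w => c t * f w), ← ENNReal.tsum_add]
          refine ENNReal.tsum_le_tsum fun w => ?_
          by_cases hw : w = y
          · subst hw
            have : r (t + 1) w = 0 := by
              simp only [hr]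
              convert measure_empty (μ := pathLaw q hq x)
              ext ω
              simp only [Set.mem_inter_iff, hAmem, Set.mem_ofPred_eq, Set.mem_empty_iff_false,
                iff_false]
              exact fun h => h.1 (t + 1) (Nat.succ_pos t) le_rfl h.2
            simp [this, hc]
          · simp only [hw, if_false, add_zero]
            refine mul_le_mul_left (measure_mono ?_) _
            refine Set.inter_subset_inter_left _ fun ω hω => ?_
            rw [hAmem] at hω ⊢
            exact fun k hk hkt => hω k hk (hkt.trans (Nat.le_succ t))
      _ = ∑' z, r t z * act q f z := by
          simp_rw [hA, pathLaw_inter_succ hq t x _ (measurableSet_avoids y t), act,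
            ← ENNReal.tsum_mul_left, ← ENNReal.tsum_mul_right]
          rw [ENNReal.tsum_comm]
          exact tsum_congr fun z => tsum_congr fun w => by rw [mul_assoc]
      _ ≤ ∑' z, r t z * f z := ENNReal.tsum_le_tsum fun z => by gcongr; exact hf z
  have hsum : ∀ n, ∑ t ∈ Finset.range n, c t * f y + ∑' z, r n z * f z ≤ f x := by
    intro n
    induction n with
    | zero =>
      simp only [Finset.range_zero, Finset.sum_empty, zero_add]
      refine le_of_le_of_eq (ENNReal.tsum_le_tsum fun z => ?_) (tsum_transProb_mul hq 0 f x)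
      gcongr
      exact measure_mono Set.inter_subset_right
    | succ n ih =>
      refine le_trans ?_ ih
      rw [Finset.sum_range_succ, add_assoc, add_comm (c n * f y)]
      gcongr
      exact hstep n
  have hQ : hitProb q hq x y ≤ ∑' t, c t := by
    refine le_trans (measure_mono ?_) (measure_iUnion_le _)
    rintro ω ⟨t, ht, hty⟩
    have hex : ∃ t, ω (t + 1) = some y := ⟨t - 1, by rwa [Nat.sub_add_cancel ht]⟩
    refine Set.mem_iUnion.2 ⟨Nat.find hex, (hAmem _ _).2 fun k hk hkt h => ?_, Nat.find_spec hex⟩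
    refine Nat.find_min hex (m := k - 1) (by omega) ?_
    rwa [Nat.sub_add_cancel hk]
  calc hitProb q hq x y * f y ≤ (∑' t, c t) * f y := by gcongr
    _ = ∑' t, c t * f y := ENNReal.tsum_mul_right.symm
    _ ≤ f x := by
        rw [ENNReal.tsum_eq_iSup_nat]
        exact iSup_le fun n => le_self_add.trans (hsum n)

theorem pathLaw_absorbed (hq : Substochastic q) (x : S) :
    ∀ᵐ ω ∂(pathLaw q hq x), ∀ t, ω t = none → ω (t + 1) = none := by
  rw [ae_all_iff]
  intro t
  have hB : MeasurableSet {v : (i : Finset.Iic t) → Option S |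
      v ⟨t, Finset.mem_Iic.2 le_rfl⟩ = none} :=
    measurableSet_eval _ fun o => o = none
  have hz : ∀ y, pathLaw q hq x (Preorder.frestrictLe t ⁻¹' {v : (i : Finset.Iic t) → Option S |
      v ⟨t, Finset.mem_Iic.2 le_rfl⟩ = none} ∩ {ω | ω (t + 1) = some y}) = 0 := by
    intro y
    rw [pathLaw_inter_succ hq t x y hB, ENNReal.tsum_eq_zero]
    intro z
    convert zero_mul (q z y)
    convert measure_empty (μ := pathLaw q hq x)
    ext ω
    simp only [Set.mem_inter_iff, Set.mem_preimage, Set.mem_ofPred_eq, Set.mem_empty_iff_false,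
      iff_false, Preorder.frestrictLe_apply]
    rintro ⟨h1, h2⟩
    rw [h1] at h2
    cases h2
  rw [ae_iff]
  refine measure_mono_null ?_ (measure_iUnion_null hz)
  intro ω hω
  simp only [Set.mem_ofPred_eq, Classical.not_imp] at hω
  obtain ⟨y, hy⟩ := Option.ne_none_iff_exists'.1 hω.2
  exact Set.mem_iUnion.2 ⟨y, hω.1, hy⟩

theorem pathLaw_absorbed_le (hq : Substochastic q) (x : S) :
    ∀ᵐ ω ∂(pathLaw q hq x), ∀ s t, s ≤ t → ω s = none → ω t = none := by
  filter_upwards [pathLaw_absorbed hq x] with ω hω s t hst hs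
  induction t, hst using Nat.le_induction with
  | base => exact hs
  | succ t _ ih => exact hω t ih

omit [Countable S] in
theorem pathLaw_start (hq : Substochastic q) (x : S) :
    ∀ᵐ ω ∂(pathLaw q hq x), ω 0 = some x := by
  classical
  have h := transProb_zero q hq x x
  simp only [if_true, transProb] at h
  exact (prob_compl_eq_zero_iff (measurableSet_eval 0 fun o => o = some x)).2 h

theorem lintegral_eval (hq : Substochastic q) (f : Option S → ℝ≥0∞) (hf : f none = 0) (n : ℕ)
    (x : S) : ∫⁻ ω, f (ω n) ∂(pathLaw q hq x) = (act q)^[n] (fun y => f (some y)) x := by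
  rw [← lintegral_map (μ := pathLaw q hq x) (f := f)
    (g := fun ω : ℕ → Option S => ω n) Measurable.of_discrete (measurable_pi_apply n),
    lintegral_countable', tsum_option_eq, hf, zero_mul, zero_add, ← tsum_transProb_mul hq]
  refine tsum_congr fun z => ?_
  rw [Measure.map_apply (measurable_pi_apply n) MeasurableSet.of_discrete, mul_comm]
  rfl

omit [Countable S] in
theorem lt_absorptionTime_iff (m n : ℕ) (ω : ℕ → Option S) :
    (n : ℕ∞) < absorptionTime m ω ↔ ∀ k, m ≤ k → k ≤ n → ω k ≠ none := by
  rw [← not_le, absorptionTime]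
  constructor
  · intro h k hk hkn hω
    exact h ((iInf₂_le k ⟨hk, hω⟩).trans (by exact_mod_cast hkn))
  · intro h h'
    have h2 : ((n + 1 : ℕ) : ℕ∞) ≤ ⨅ (k : ℕ) (_ : m ≤ k ∧ ω k = none), (k : ℕ∞) := by
      refine le_iInf₂ fun k hk => ?_
      by_contra hlt
      refine h k hk.1 ?_ hk.2
      have : k < n + 1 := by exact_mod_cast not_le.1 hlt
      omega
    have h3 := h2.trans h'
    have : n + 1 ≤ n := by exact_mod_cast h3
    omega

/-- Absorption makes the restriction to `T > n` automatic: off this event the path is already in the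
cemetery, where the extended function vanishes. -/
theorem killedMean_eq (hq : Substochastic q) (f : S → ℝ≥0) (n : ℕ) (x : S) :
    killedMean q hq f n x = (act q)^[n] (fun y => (f y : ℝ≥0∞)) x := by
  have hms : MeasurableSet {ω : ℕ → Option S | (n : ℕ∞) < absorptionTime 0 ω} := by
    have : {ω : ℕ → Option S | (n : ℕ∞) < absorptionTime 0 ω}
        = ⋂ (k : ℕ), ⋂ (_ : k ≤ n), {ω | ω k ≠ none} := by
      ext ω; simp [lt_absorptionTime_iff]
    rw [this]
    exact MeasurableSet.iInter fun k => MeasurableSet.iInter fun _ =>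
      measurableSet_eval k fun o => o ≠ none
  rw [killedMean, ← lintegral_indicator hms]
  refine Eq.trans ?_ (lintegral_eval hq (extendZero f) rfl n x)
  refine lintegral_congr_ae ?_
  filter_upwards [pathLaw_absorbed_le hq x] with ω hω
  by_cases h : ω ∈ {ω : ℕ → Option S | (n : ℕ∞) < absorptionTime 0 ω}
  · rw [Set.indicator_of_mem h]
  · rw [Set.indicator_of_notMem h]
    simp only [Set.mem_ofPred_eq, lt_absorptionTime_iff] at h
    push Not at h
    obtain ⟨k, -, hk, hk'⟩ := h
    rw [hω k n hk hk']
    rfl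

theorem natCast_eq_tsum (a : ℕ∞) : (a : ℝ≥0∞) = ∑' n : ℕ, if (n : ℕ∞) < a then 1 else 0 := by
  induction a with
  | top => simp
  | coe k =>
    rw [tsum_eq_sum (s := Finset.range k)]
    · rw [Finset.sum_congr rfl (g := fun _ => 1)]
      · simp
      · intro n hn; simp [Finset.mem_range.1 hn]
    · intro n hn; simpa using hn

/-- Tail-sum formula, with `q^n 1` the survival probabilities. The chain starts outside the
cemetery, so infima over times `≥ 0` and `≥ 1` agree; this covers both `V` and the mean exit time.
-/
theorem meanAbsorptionTime_eq (hq : Substochastic q) {m : ℕ} (hm : m ≤ 1) (x : S) :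
    meanAbsorptionTime q hq m x = ∑' n, (act q)^[n] 1 x := by
  classical
  have h1 : ∀ᵐ ω ∂(pathLaw q hq x), ((absorptionTime m ω : ℕ∞) : ℝ≥0∞)
      = ∑' n, (fun o : Option S => o.elim 0 (fun _ => (1 : ℝ≥0∞))) (ω n) := by
    filter_upwards [pathLaw_absorbed_le hq x, pathLaw_start hq x] with ω hω h0
    rw [natCast_eq_tsum]
    refine tsum_congr fun n => ?_
    have key : (n : ℕ∞) < absorptionTime m ω ↔ ω n ≠ none := by
      rw [lt_absorptionTime_iff]
      constructor
      · intro h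
        rcases Nat.eq_zero_or_pos n with rfl | hn
        · simp [h0]
        · exact h n (by omega) le_rfl
      · intro h k _ hkn hk
        exact h (hω k n hkn hk)
    cases hn : ω n with
    | none => simp [key, hn]
    | some y => simp [key, hn]
  rw [meanAbsorptionTime, lintegral_congr_ae h1, lintegral_tsum]
  · exact tsum_congr fun n => lintegral_eval hq (fun o => o.elim 0 fun _ => 1) rfl n x
  · intro n
    exact ((Measurable.of_discrete (f := fun o : Option S => o.elim 0 (fun _ => (1 : ℝ≥0∞)))).comp
      (measurable_pi_apply n)).aemeasurable

end Paths

/-! ### Operators on a cone of functions -/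

section Cone

variable {X : Type*} {K : Set (X → ℝ≥0∞)} {T : (X → ℝ≥0∞) → X → ℝ≥0∞}

/-- A family of pointwise inequalities `T k ≤ c k` holds for the infimum of the admissible `c`. -/
theorem exists_least_upper_factor (hfin : ∀ k ∈ K, ∀ x, k x ≠ ∞)
    (hC : ∃ C : ℝ≥0, ∀ k ∈ K, ∀ x, T k x ≤ C * k x) :
    ∃ c : ℝ≥0, (∀ k ∈ K, ∀ x, T k x ≤ c * k x) ∧
      ∀ c' : ℝ≥0, (∀ k ∈ K, ∀ x, T k x ≤ c' * k x) → c ≤ c' := by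
  set A : Set ℝ≥0 := {c | ∀ k ∈ K, ∀ x, T k x ≤ c * k x} with hA
  have hcl : IsClosed A := by
    have : A = ⋂ k ∈ K, ⋂ x, {c : ℝ≥0 | T k x ≤ c * k x} := by ext; simp [hA]
    rw [this]
    refine isClosed_biInter fun k hk => isClosed_iInter fun x => isClosed_le continuous_const ?_
    exact (ENNReal.continuous_mul_const (hfin k hk x)).comp ENNReal.continuous_coe
  exact ⟨sInf A, hcl.csInf_mem hC (OrderBot.bddBelow A), fun c' hc' => csInf_le' hc'⟩

/-- A family of pointwise inequalities `c k ≤ T k ≤ k` holds for the largest admissible `c`. -/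
theorem exists_greatest_lower_factor (hfin : ∀ k ∈ K, ∀ x, k x ≠ ∞)
    (hne : ∃ k ∈ K, ∃ x, k x ≠ 0) (hle : ∀ k ∈ K, ∀ x, T k x ≤ k x) :
    ∃ c : ℝ≥0, (∀ k ∈ K, ∀ x, c * k x ≤ T k x) ∧
      ∀ c' : ℝ≥0, (∀ k ∈ K, ∀ x, c' * k x ≤ T k x) → c' ≤ c := by
  set A : Set ℝ≥0 := {c | ∀ k ∈ K, ∀ x, c * k x ≤ T k x} with hA
  have hcl : IsClosed A := by
    have : A = ⋂ k ∈ K, ⋂ x, {c : ℝ≥0 | c * k x ≤ T k x} := by ext; simp [hA]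
    rw [this]
    refine isClosed_biInter fun k hk => isClosed_iInter fun x => isClosed_le ?_ continuous_const
    exact (ENNReal.continuous_mul_const (hfin k hk x)).comp ENNReal.continuous_coe
  have hbdd : BddAbove A := by
    obtain ⟨k, hk, x, hx⟩ := hne
    refine ⟨1, fun c hc => ?_⟩
    have h := (hc k hk x).trans (hle k hk x)
    lift k x to ℝ≥0 using hfin k hk x with a
    norm_cast at h hx
    have ha : 0 < a := pos_iff_ne_zero.2 hx
    exact (mul_le_iff_le_one_left ha).1 h
  exact ⟨sSup A, hcl.csSup_mem ⟨0, fun k _ x => by simp⟩ hbdd, fun c' hc' => le_csSup hbdd hc'⟩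

/-- If `T² ≤ b²` on a cone stable under `C - T`, then `T ≤ b`. -/
theorem le_of_sq_le (hfin : ∀ k ∈ K, ∀ x, k x ≠ ∞) (hT : ∀ k ∈ K, T k ∈ K)
    (hsub : ∀ k ∈ K, ∀ c : ℝ≥0, (∀ x, T k x ≤ c * k x) →
      ∃ k' ∈ K, (∀ x, k' x + T k x = c * k x) ∧ ∀ x, T k' x + T (T k) x = c * T k x)
    (hC : ∃ C : ℝ≥0, ∀ k ∈ K, ∀ x, T k x ≤ C * k x) {b : ℝ≥0}
    (hb : ∀ k ∈ K, ∀ x, T (T k) x ≤ (b ^ 2 : ℝ≥0) * k x) :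
    ∀ k ∈ K, ∀ x, T k x ≤ b * k x := by
  obtain ⟨c, hc, hmin⟩ := exists_least_upper_factor hfin hC
  rcases le_or_gt c b with hcb | hcb
  · exact fun k hk x => (hc k hk x).trans (by gcongr)
  have hc0 : (0 : ℝ) < c := lt_of_le_of_lt b.2 hcb
  -- Applying `T ≤ c` to `(c - T) k` gives `2c T k ≤ c² k + T² k ≤ (c² + b²) k`. Minimality of `c`
  -- then yields `2c² ≤ c² + b²`.
  have hnew : ∀ k ∈ K, ∀ x, T k x ≤ (((c ^ 2 + b ^ 2) / (2 * c) : ℝ≥0) : ℝ≥0∞) * k x := by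
    intro k hk x
    obtain ⟨k', hk', h1, h2⟩ := hsub k hk c (hc k hk)
    have e1 := h1 x
    have e2 := h2 x
    have e3 := hc k' hk' x
    have e4 := hb k hk x
    have f1 := hfin k hk x
    have f2 := hfin _ (hT k hk) x
    have f3 := hfin _ (hT _ (hT k hk)) x
    have f4 := hfin k' hk' x
    have f5 := hfin _ (hT k' hk') x
    generalize k x = a at *
    generalize T k x = a1 at *
    generalize T (T k) x = a2 at *
    generalize k' x = a3 at *
    generalize T k' x = a4 at *
    lift a to ℝ≥0 using f1
    lift a1 to ℝ≥0 using f2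
    lift a2 to ℝ≥0 using f3
    lift a3 to ℝ≥0 using f4
    lift a4 to ℝ≥0 using f5
    norm_cast at e1 e2 e3 e4 ⊢
    rw [← NNReal.coe_le_coe] at e3 e4 ⊢
    rw [← NNReal.coe_inj] at e1 e2
    push_cast at e1 e2 e3 e4 ⊢
    rw [div_mul_eq_mul_div, le_div_iff₀ (by positivity)]
    have : (c : ℝ) * a3 + c * a1 = c ^ 2 * a := by rw [← mul_add, e1]; ring
    nlinarith
  have h := hmin _ hnew
  rw [← NNReal.coe_le_coe] at h
  push_cast at h
  rw [le_div_iff₀ (by positivity)] at h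
  have hcb' : (b : ℝ) < c := hcb
  nlinarith [b.2]

/-- If `T ≤ 1` and `T² ≥ b²` on a cone stable under `1 - T`, then `T ≥ b`. -/
theorem le_of_le_sq (hfin : ∀ k ∈ K, ∀ x, k x ≠ ∞) (hT : ∀ k ∈ K, T k ∈ K)
    (hsub : ∀ k ∈ K, ∀ c : ℝ≥0, (∀ x, T k x ≤ c * k x) →
      ∃ k' ∈ K, (∀ x, k' x + T k x = c * k x) ∧ ∀ x, T k' x + T (T k) x = c * T k x)
    (hle : ∀ k ∈ K, ∀ x, T k x ≤ k x) {b : ℝ≥0}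
    (hb : ∀ k ∈ K, ∀ x, (b ^ 2 : ℝ≥0) * k x ≤ T (T k) x) :
    ∀ k ∈ K, ∀ x, b * k x ≤ T k x := by
  by_cases hne : ∃ k ∈ K, ∃ x, k x ≠ 0
  swap
  · push Not at hne
    intro k hk x
    simp [hne k hk x]
  obtain ⟨c, hc, hmax⟩ := exists_greatest_lower_factor hfin hne hle
  -- Applying `c ≤ T` to `(1 - T) k` gives `(1 + c) T k ≥ c k + T² k ≥ (c + b²) k`. Maximality of
  -- `c` then yields `b² ≤ c²`.
  have hnew : ∀ k ∈ K, ∀ x, (((c + b ^ 2) / (1 + c) : ℝ≥0) : ℝ≥0∞) * k x ≤ T k x := by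
    intro k hk x
    obtain ⟨k', hk', h1, h2⟩ := hsub k hk 1 (by simpa using hle k hk)
    have e1 := h1 x
    have e2 := h2 x
    have e3 := hc k' hk' x
    have e4 := hb k hk x
    have f1 := hfin k hk x
    have f2 := hfin _ (hT k hk) x
    have f3 := hfin _ (hT _ (hT k hk)) x
    have f4 := hfin k' hk' x
    have f5 := hfin _ (hT k' hk') x
    generalize k x = a at *
    generalize T k x = a1 at *
    generalize T (T k) x = a2 at *
    generalize k' x = a3 at *
    generalize T k' x = a4 at *
    lift a to ℝ≥0 using f1
    lift a1 to ℝ≥0 using f2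
    lift a2 to ℝ≥0 using f3
    lift a3 to ℝ≥0 using f4
    lift a4 to ℝ≥0 using f5
    norm_cast at e1 e2 e3 e4 ⊢
    rw [← NNReal.coe_le_coe] at e3 e4 ⊢
    rw [← NNReal.coe_inj] at e1 e2
    push_cast at e1 e2 e3 e4 ⊢
    rw [div_mul_eq_mul_div, div_le_iff₀ (by positivity)]
    have : (c : ℝ) * a3 + c * a1 = c * a := by rw [← mul_add, e1]; ring
    nlinarith
  have h := hmax _ hnew
  rw [← NNReal.coe_le_coe] at h
  push_cast at h
  rw [div_le_iff₀ (by positivity)] at h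
  have hcb : b ≤ c := by
    rw [← NNReal.coe_le_coe]
    exact abs_le_of_sq_le_sq' (by nlinarith) c.coe_nonneg |>.2
  exact fun k hk x => le_trans (by gcongr) (hc k hk x)

end Cone

/-! ### Harmonic functions and right translations -/

section Walk

variable {𝓔 : Type*} [Group 𝓔] {E : Submonoid 𝓔} {p : E → E → ℝ≥0∞}

/-- The cone of finite harmonic functions. -/
def harmonicCone (p : E → E → ℝ≥0∞) : Set (E → ℝ≥0∞) := {f | (∀ x, f x ≠ ∞) ∧ act p f = f}

/-- The greatest harmonic minorant of `x ↦ f(x ⋆ u)`. -/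
noncomputable def transHarm (p : E → E → ℝ≥0∞) (u : E) (f : E → ℝ≥0∞) (x : E) : ℝ≥0∞ :=
  ⨅ n, (act p)^[n] (fun y => f (y * u)) x

theorem act_translate_le (hB : TranslationMonotone p) (u : E) (f : E → ℝ≥0∞) :
    act p (fun y => f (y * u)) ≤ fun x => act p f (x * u) := by
  intro x
  have hinj : Function.Injective (fun y : E => y * u) := fun a b h => by simpa using h
  calc act p (fun y => f (y * u)) x ≤ ∑' y, p (x * u) (y * u) * f (y * u) :=
        ENNReal.tsum_le_tsum fun y => mul_le_mul_left (hB x y u) _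
    _ ≤ act p f (x * u) :=
        ENNReal.tsum_comp_le_tsum_of_injective hinj fun w => p (x * u) w * f w

theorem act_iterate_translate_le (hB : TranslationMonotone p) (u : E) (f : E → ℝ≥0∞) (n : ℕ) :
    (act p)^[n] (fun y => f (y * u)) ≤ fun x => (act p)^[n] f (x * u) := by
  induction n with
  | zero => exact le_rfl
  | succ n ih =>
    simp only [Function.iterate_succ_apply']
    exact (act_mono ih).trans (act_translate_le hB u _)

theorem translate_superharmonic (hB : TranslationMonotone p) (u : E) {f : E → ℝ≥0∞}
    (hf : f ∈ harmonicCone p) : act p (fun y => f (y * u)) ≤ fun y => f (y * u) := by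
  have h := act_translate_le hB u f
  rwa [hf.2] at h

theorem transHarm_le (u : E) (f : E → ℝ≥0∞) (x : E) : transHarm p u f x ≤ f (x * u) :=
  iInf_le (fun n => (act p)^[n] (fun y => f (y * u)) x) 0

theorem transHarm_mem [Countable E] (hp : Substochastic p) (hB : TranslationMonotone p) (u : E)
    {f : E → ℝ≥0∞} (hf : f ∈ harmonicCone p) : transHarm p u f ∈ harmonicCone p :=
  ⟨fun x => ne_top_of_le_ne_top (hf.1 _) (transHarm_le u f x),
    act_iInf_iterate hp (translate_superharmonic hB u hf) fun _ => hf.1 _⟩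

theorem le_transHarm {u : E} {f g : E → ℝ≥0∞} (hg : g ∈ harmonicCone p)
    (h : ∀ x, g x ≤ f (x * u)) (x : E) : g x ≤ transHarm p u f x :=
  le_iInf fun n => by
    conv_lhs => rw [← iterate_eq_self hg.2 n]
    exact act_iterate_mono h n x

theorem transHarm_tendsto (hB : TranslationMonotone p) (u : E) {f : E → ℝ≥0∞}
    (hf : f ∈ harmonicCone p) (x : E) :
    Tendsto (fun n => (act p)^[n] (fun y => f (y * u)) x) atTop (𝓝 (transHarm p u f x)) :=
  tendsto_atTop_iInf fun _ _ hmn => iterate_antitone (translate_superharmonic hB u hf) hmn x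

theorem add_mem_harmonicCone {f g : E → ℝ≥0∞} (hf : f ∈ harmonicCone p)
    (hg : g ∈ harmonicCone p) : f + g ∈ harmonicCone p :=
  ⟨fun x => ENNReal.add_ne_top.2 ⟨hf.1 x, hg.1 x⟩, by rw [act_add, hf.2, hg.2]⟩

theorem smul_mem_harmonicCone (c : ℝ≥0) {f : E → ℝ≥0∞} (hf : f ∈ harmonicCone p) :
    (fun x => (c : ℝ≥0∞) * f x) ∈ harmonicCone p :=
  ⟨fun x => ENNReal.mul_ne_top ENNReal.coe_ne_top (hf.1 x), by rw [act_smul, hf.2]⟩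

theorem sub_mem_harmonicCone {f g : E → ℝ≥0∞} (hf : f ∈ harmonicCone p)
    (hg : g ∈ harmonicCone p) (hle : g ≤ f) : f - g ∈ harmonicCone p := by
  refine ⟨fun x => ne_top_of_le_ne_top (hf.1 x) tsub_le_self, funext fun x => ?_⟩
  have h := congrFun (act_add (q := p) (f - g) g) x
  rw [tsub_add_cancel_of_le hle, hf.2, hg.2, Pi.add_apply] at h
  rw [Pi.sub_apply, h, ENNReal.add_sub_cancel_right (hg.1 x)]

theorem transHarm_add (hB : TranslationMonotone p) (u : E) {f g : E → ℝ≥0∞}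
    (hf : f ∈ harmonicCone p) (hg : g ∈ harmonicCone p) :
    transHarm p u (f + g) = transHarm p u f + transHarm p u g := by
  funext x
  refine tendsto_nhds_unique (transHarm_tendsto hB u (add_mem_harmonicCone hf hg) x) ?_
  refine ((transHarm_tendsto hB u hf x).add (transHarm_tendsto hB u hg x)).congr fun n => ?_
  rw [← Pi.add_apply, ← act_iterate_add]
  rfl

theorem transHarm_smul (u : E) (c : ℝ≥0) (f : E → ℝ≥0∞) :
    transHarm p u (fun x => (c : ℝ≥0∞) * f x) = fun x => (c : ℝ≥0∞) * transHarm p u f x := by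
  funext x
  simp only [transHarm, act_iterate_smul (c : ℝ≥0∞) (fun y => f (y * u))]
  exact (ENNReal.mul_iInf fun h => absurd h ENNReal.coe_ne_top).symm

/-- The left side is a harmonic minorant of the translate by `u²`. Conversely, the right side lies
below the translate by `u` of `T_u f`, since iterating `p` before translating gives at least as much
as after; being harmonic, it lies below `T_u (T_u f)`. -/
theorem transHarm_transHarm [Countable E] (hp : Substochastic p) (hB : TranslationMonotone p)
    (u : E) {f : E → ℝ≥0∞} (hf : f ∈ harmonicCone p) :
    transHarm p u (transHarm p u f) = transHarm p (u ^ 2) f := by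
  have hu : ∀ y : E, y * u ^ 2 = y * u * u := fun y => by rw [sq, mul_assoc]
  funext x
  refine le_antisymm (le_transHarm (transHarm_mem hp hB u (transHarm_mem hp hB u hf))
    (fun y => ?_) x) (le_iInf fun m => ?_)
  · rw [hu]
    exact (transHarm_le u _ y).trans (transHarm_le u f _)
  · have h1 : transHarm p (u ^ 2) f ≤ fun y => transHarm p u f (y * u) := by
      intro y
      refine le_iInf fun n => (iInf_le _ n).trans ?_
      simp only [hu]
      exact act_iterate_translate_le hB u (fun y => f (y * u)) n y
    conv_lhs => rw [← iterate_eq_self (transHarm_mem hp hB (u ^ 2) hf).2 m]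
    exact act_iterate_mono h1 m x

/-- The stability under `c - T` required by the square-root lemmas. Differences are expressed as
sums because subtraction in `ℝ≥0∞` is truncated. -/
theorem transHarm_sub [Countable E] (hp : Substochastic p) (hB : TranslationMonotone p) (u : E)
    {k : E → ℝ≥0∞} (hk : k ∈ harmonicCone p) (c : ℝ≥0) (hc : ∀ x, transHarm p u k x ≤ c * k x) :
    ∃ k' ∈ harmonicCone p, (∀ x, k' x + transHarm p u k x = c * k x) ∧
      ∀ x, transHarm p u k' x + transHarm p u (transHarm p u k) x = c * transHarm p u k x := by
  have hT := transHarm_mem hp hB u hk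
  have hk' := sub_mem_harmonicCone (smul_mem_harmonicCone c hk) hT hc
  have hadd := tsub_add_cancel_of_le (a := transHarm p u k) (b := fun x => (c : ℝ≥0∞) * k x) hc
  refine ⟨_, hk', fun x => congrFun hadd x, fun x => ?_⟩
  rw [← Pi.add_apply, ← transHarm_add hB u hk' hT, hadd, transHarm_smul]

/-- The square root is extracted `m` times, once for each squaring of `u`. -/
theorem transHarm_le_of_pow [Countable E] (hp : Substochastic p) (hB : TranslationMonotone p)
    (hC : ∀ u : E, ∃ C : ℝ≥0, ∀ k ∈ harmonicCone p, ∀ x, transHarm p u k x ≤ C * k x) (m : ℕ)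
    (u : E) (b : ℝ≥0)
    (h : ∀ k ∈ harmonicCone p, ∀ x, transHarm p (u ^ 2 ^ m) k x ≤ (b ^ 2 ^ m : ℝ≥0) * k x) :
    ∀ k ∈ harmonicCone p, ∀ x, transHarm p u k x ≤ b * k x := by
  induction m generalizing u b with
  | zero => simpa using h
  | succ m ih =>
    have h2 := ih (u ^ 2) (b ^ 2) (by simpa only [← pow_mul, pow_succ' 2 m] using h)
    refine le_of_sq_le (fun k hk => hk.1) (fun k hk => transHarm_mem hp hB u hk)
      (fun k hk c hc => transHarm_sub hp hB u hk c hc) (hC u) fun k hk x => ?_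
    rw [transHarm_transHarm hp hB u hk]
    exact h2 k hk x

theorem le_transHarm_of_pow [Countable E] (hp : Substochastic p) (hB : TranslationMonotone p)
    (hle : ∀ u : E, ∀ k ∈ harmonicCone p, ∀ x, transHarm p u k x ≤ k x) (m : ℕ)
    (u : E) (b : ℝ≥0)
    (h : ∀ k ∈ harmonicCone p, ∀ x, (b ^ 2 ^ m : ℝ≥0) * k x ≤ transHarm p (u ^ 2 ^ m) k x) :
    ∀ k ∈ harmonicCone p, ∀ x, b * k x ≤ transHarm p u k x := by
  induction m generalizing u b with
  | zero => simpa using h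
  | succ m ih =>
    have h2 := ih (u ^ 2) (b ^ 2) (by simpa only [← pow_mul, pow_succ' 2 m] using h)
    refine le_of_le_sq (fun k hk => hk.1) (fun k hk => transHarm_mem hp hB u hk)
      (fun k hk c hc => transHarm_sub hp hB u hk c hc) (hle u) fun k hk x => ?_
    rw [transHarm_transHarm hp hB u hk]
    exact h2 k hk x

/-- Positivity of `Q` has to be assumed separately: `Real.log 0 = 0` would satisfy the bound on the
logarithm. -/
theorem inv_pow_le_of_abs_log_lt {Q : ℝ≥0∞} (hQ : 0 < Q) (hQ' : Q ≠ ∞) {b : ℝ≥0} (hb : 1 < b)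
    {n : ℕ} (hn : 0 < n) (h : |0 - 1 / (n : ℝ) * Real.log Q.toReal| < Real.log b) :
    1 ≤ ((b ^ n : ℝ≥0) : ℝ≥0∞) * Q := by
  lift Q to ℝ≥0 using hQ'
  have hQ0 : (0 : ℝ) < Q := by exact_mod_cast hQ
  have hb0 : (0 : ℝ) < b := lt_trans one_pos (by exact_mod_cast hb)
  have hn' : (0 : ℝ) < n := by exact_mod_cast hn
  rw [ENNReal.coe_toReal, abs_lt] at h
  have h1 := h.2
  rw [zero_sub, neg_lt, one_div, inv_mul_eq_div, lt_div_iff₀ hn'] at h1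
  have h2 : 0 ≤ Real.log ((b : ℝ) ^ n * Q) := by
    rw [Real.log_mul (by positivity) hQ0.ne', Real.log_pow]
    linarith
  have h3 := (Real.log_nonneg_iff (by positivity)).1 h2
  exact_mod_cast h3

theorem SlowlyVaryingAlong.eventually {hp : Substochastic p} {u : E}
    (h : SlowlyVaryingAlong p hp u) {b : ℝ≥0} (hb : 1 < b) :
    ∀ᶠ n : ℕ in atTop, ∀ x : E, 1 ≤ ((b ^ n : ℝ≥0) : ℝ≥0∞) * hitProb p hp x (x * u ^ n) ∧
      1 ≤ ((b ^ n : ℝ≥0) : ℝ≥0∞) * hitProb p hp (x * u ^ n) x := by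
  obtain ⟨h0, h1, h2⟩ := h
  have hlog : 0 < Real.log b := Real.log_pos (by exact_mod_cast hb)
  rw [Metric.tendstoUniformly_iff] at h1 h2
  filter_upwards [h0, h1 _ hlog, h2 _ hlog, eventually_gt_atTop 0] with n h0 h1 h2 hn x
  exact ⟨inv_pow_le_of_abs_log_lt (h0 x).1 (measure_ne_top _ _) hb hn (h1 x),
    inv_pow_le_of_abs_log_lt (h0 x).2 (measure_ne_top _ _) hb hn (h2 x)⟩

/-- A Harnack inequality whose constant does not depend on the harmonic function. -/
theorem le_mul_of_hitProb [Countable E] (hp : Substochastic p) {f : E → ℝ≥0∞}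
    (hf : f ∈ harmonicCone p) {x y : E} {c : ℝ≥0∞} (h : 1 ≤ c * hitProb p hp x y) :
    f y ≤ c * f x :=
  calc f y ≤ c * hitProb p hp x y * f y := le_mul_of_one_le_left' h
    _ = c * (hitProb p hp x y * f y) := mul_assoc _ _ _
    _ ≤ c * f x := by gcongr; exact hitProb_mul_le hp hf.2.le x y

/-- Under slow variation, the harmonic part of every translate of `f` is `f`. -/
theorem transHarm_eq_self [Countable E] (hp : Substochastic p) (hB : TranslationMonotone p)
    (hslow : ∀ u : E, SlowlyVaryingAlong p hp u) {f : E → ℝ≥0∞} (hf : f ∈ harmonicCone p)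
    (u : E) : transHarm p u f = f := by
  have hpow : Tendsto (fun m : ℕ => 2 ^ m) atTop atTop := tendsto_pow_atTop_atTop_of_one_lt one_lt_two
  have hC : ∀ u : E, ∃ C : ℝ≥0, ∀ k ∈ harmonicCone p, ∀ x, transHarm p u k x ≤ C * k x := by
    intro u
    have hev := (hslow u).eventually (b := 2) one_lt_two
    -- The comparison of `x ⋆ u` with `x` goes through `x ⋆ u^(n+1)`: back by `n` steps from it to
    -- `x ⋆ u`, and forward by `n + 1` steps from `x`. Hence two consecutive good exponents.
    obtain ⟨n, hn, hn'⟩ := (hev.and ((tendsto_add_atTop_nat 1).eventually hev)).exists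
    refine ⟨2 ^ n * 2 ^ (n + 1), fun k hk x => (transHarm_le u k x).trans ?_⟩
    have h1 := le_mul_of_hitProb hp hk (hn (x * u)).2
    have h2 := le_mul_of_hitProb hp hk (hn' x).1
    rw [mul_assoc, ← pow_succ'] at h1
    refine h1.trans ?_
    rw [ENNReal.coe_mul, mul_assoc]
    gcongr
  have hup : ∀ u : E, ∀ k ∈ harmonicCone p, ∀ x, transHarm p u k x ≤ k x := by
    intro u k hk x
    have h1 : ∀ b : ℝ≥0, 1 < b → transHarm p u k x ≤ b * k x := by
      intro b hb
      obtain ⟨m, hm⟩ := (hpow.eventually ((hslow u).eventually hb)).exists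
      exact transHarm_le_of_pow hp hB hC m u b (fun k hk x => (transHarm_le _ k x).trans
        (le_mul_of_hitProb hp hk (hm x).1)) k hk x
    have hcont : Continuous fun b : ℝ≥0 => (b : ℝ≥0∞) * k x :=
      (ENNReal.continuous_mul_const (hk.1 x)).comp ENNReal.continuous_coe
    have h2 := ge_of_tendsto (hcont.continuousWithinAt (s := Set.Ioi 1) (x := 1)).tendsto
      (eventually_nhdsWithin_of_forall h1)
    simpa using h2
  -- The lower square-root lemma needs `T ≤ 1`, so the upper bound `hup` had to come first.
  have hlow : ∀ b : ℝ≥0, 1 < b → ∀ x, (b⁻¹ : ℝ≥0) * f x ≤ transHarm p u f x := by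
    intro b hb x
    obtain ⟨m, hm⟩ := (hpow.eventually ((hslow u).eventually hb)).exists
    refine le_transHarm_of_pow hp hB hup m u b⁻¹ (fun k hk x => ?_) f hf x
    refine le_transHarm (smul_mem_harmonicCone _ hk) (fun y => ?_) x
    have hb0 : b ^ 2 ^ m ≠ 0 := pow_ne_zero _ (one_pos.trans hb).ne'
    rw [inv_pow, ENNReal.coe_inv hb0]
    exact ENNReal.inv_mul_le_iff (by simpa using hb0) ENNReal.coe_ne_top |>.2
      (le_mul_of_hitProb hp hk (hm y).2)
  funext x
  refine le_antisymm (hup u f hf x) ?_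
  have hcont : ContinuousAt (fun b : ℝ≥0 => ((b⁻¹ : ℝ≥0) : ℝ≥0∞) * f x) 1 :=
    (((ENNReal.continuous_mul_const (hf.1 x)).comp ENNReal.continuous_coe).continuousAt).comp
      (f := fun b : ℝ≥0 => b⁻¹) (continuousAt_inv₀ one_ne_zero)
  have h2 := le_of_tendsto (hcont.continuousWithinAt (s := Set.Ioi 1)).tendsto
    (eventually_nhdsWithin_of_forall fun b hb => hlow b hb x)
  simpa using h2

end Walk

/-! ### Comparison with potentials, and dominated convergence -/

section Bounds

variable {S : Type*} {q : S → S → ℝ≥0∞}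

/-- Minimality of the potential: in the iterated inequality the remainder `q^n g` is non-negative
and can be dropped. -/
theorem tsum_iterate_le {g d : S → ℝ≥0∞} (hg : d + act q g ≤ g) (x : S) :
    ∑' k, (act q)^[k] d x ≤ g x := by
  have h : ∀ n x, ∑ k ∈ Finset.range n, (act q)^[k] d x + (act q)^[n] g x ≤ g x := by
    intro n x
    induction n with
    | zero => simp
    | succ n ih =>
      refine le_trans ?_ ih
      rw [Finset.sum_range_succ, add_assoc, Function.iterate_succ_apply, ← Pi.add_apply (f := _),
        ← act_iterate_add]
      gcongr
      exact act_iterate_mono hg n x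
  rw [ENNReal.tsum_eq_iSup_nat]
  exact iSup_le fun n => le_self_add.trans (h n x)

/-- The reverse comparison needs the remainder `q^n g` to vanish. It does: it is at most `M q^n 1`,
the general term of a convergent series. -/
theorem le_tsum_iterate {g : S → ℝ≥0∞} {c M : ℝ≥0} (hg : ∀ x, g x ≤ c + act q g x)
    (hM : ∀ x, g x ≤ M) (hfin : ∀ x, ∑' k, (act q)^[k] 1 x ≠ ∞) (x : S) :
    g x ≤ c * ∑' k, (act q)^[k] 1 x := by
  have h : ∀ n, g x ≤ c * ∑ k ∈ Finset.range n, (act q)^[k] 1 x + (act q)^[n] g x := by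
    intro n
    induction n with
    | zero => simp
    | succ n ih =>
      refine ih.trans ?_
      rw [Finset.sum_range_succ, mul_add, add_assoc]
      gcongr
      have h1 := act_iterate_mono (q := q)
        (show g ≤ (fun y => (c : ℝ≥0∞) * (1 : S → ℝ≥0∞) y) + act q g from fun y => by
          simpa using hg y) n x
      rwa [act_iterate_add, act_iterate_smul, ← Function.iterate_succ_apply] at h1
  have hM' : ∀ n, (act q)^[n] g x ≤ M * (act q)^[n] 1 x := fun n => by
    have h1 := act_iterate_mono (q := q)
      (show g ≤ fun y => (M : ℝ≥0∞) * (1 : S → ℝ≥0∞) y from fun y => by simpa using hM y) n x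
    rwa [act_iterate_smul] at h1
  have h1 : Tendsto (fun n => (c : ℝ≥0∞) * ∑ k ∈ Finset.range n, (act q)^[k] 1 x
      + M * (act q)^[n] 1 x) atTop (𝓝 (c * ∑' k, (act q)^[k] 1 x + M * 0)) :=
    (ENNReal.Tendsto.const_mul (ENNReal.tendsto_nat_tsum _) (Or.inr ENNReal.coe_ne_top)).add
      (ENNReal.Tendsto.const_mul (ENNReal.tendsto_atTop_zero_of_tsum_ne_top (hfin x))
        (Or.inr ENNReal.coe_ne_top))
  rw [mul_zero, add_zero] at h1
  exact ge_of_tendsto' h1 fun n => (h n).trans (by gcongr; exact hM' n)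

/-- Dominated convergence. -/
theorem tendsto_act (hq : Substochastic q) {ι : Type*} {l : Filter ι} {g : ι → S → ℝ≥0∞}
    {v b : S → ℝ≥0∞} (hg : ∀ i, g i ≤ b) (hv : v ≤ b)
    (hlim : ∀ x, Tendsto (fun i => g i x) l (𝓝 (v x))) {x : S} (hb : act q b x ≠ ∞) :
    Tendsto (fun i => act q (g i) x) l (𝓝 (act q v x)) := by
  have hq' : ∀ y, q x y ≠ ∞ := fun y =>
    ne_top_of_le_ne_top ENNReal.one_ne_top ((ENNReal.le_tsum y).trans (hq x))
  have hterm : ∀ y, q x y * b y ≠ ∞ := ENNReal.ne_top_of_tsum_ne_top hb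
  have hle : ∀ f ≤ b, ∀ y, q x y * f y ≤ q x y * b y := fun f hf y => mul_le_mul_right (hf y) _
  have hterm' : ∀ f ≤ b, ∀ y, q x y * f y ≠ ∞ := fun f hf y =>
    ne_top_of_le_ne_top (hterm y) (hle f hf y)
  have hact : ∀ f ≤ b, act q f x ≠ ∞ := fun f hf => ne_top_of_le_ne_top hb (act_mono hf x)
  rw [← ENNReal.tendsto_toReal_iff (fun i => hact _ (hg i)) (hact v hv)]
  have e : ∀ f ≤ b, (act q f x).toReal = ∑' y, (q x y * f y).toReal := fun f hf =>
    ENNReal.tsum_toReal_eq (hterm' f hf)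
  simp only [e _ (hg _), e v hv]
  refine tendsto_tsum_of_dominated_convergence (ENNReal.summable_toReal hb) (fun y => ?_)
    (Eventually.of_forall fun i y => ?_)
  · exact (ENNReal.tendsto_toReal (hterm' v hv y)).comp
      (ENNReal.Tendsto.const_mul (hlim y) (Or.inr (hq' y)))
  · rw [Real.norm_of_nonneg ENNReal.toReal_nonneg]
    exact ENNReal.toReal_mono (hterm y) (hle _ (hg i) y)

end Bounds

/-! ### Ladder heights, the renewal function and the mean exit time -/

section Ladder

variable {𝓔 : Type*} [Group 𝓔] {E : Submonoid 𝓔} {p : E → E → ℝ≥0∞}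

/-- The row of `p` at `x ⋆ u` is the translated row at `x` plus the excess. For harmonic `f` this
identifies `a_u f` as the defect of the translate of `f`. -/
theorem act_excessMatrix_add (hB : TranslationMonotone p) (f : E → ℝ≥0∞) (u x : E) :
    act (excessMatrix p u) f x + act p (fun y => f (y * u)) x = act p f (x * u) := by
  classical
  have hinj : Function.Injective (fun y : E => y * u) := fun a b h => by simpa using h
  have h1 : act p (fun y => f (y * u)) x
      = ∑' y : E, (if h : (y : 𝓔) * (u : 𝓔)⁻¹ ∈ E then p x ⟨(y : 𝓔) * (u : 𝓔)⁻¹, h⟩ else 0)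
        * f y := by
    rw [← hinj.tsum_eq (f := fun y : E =>
      (if h : (y : 𝓔) * (u : 𝓔)⁻¹ ∈ E then p x ⟨(y : 𝓔) * (u : 𝓔)⁻¹, h⟩ else 0) * f y)]
    · refine tsum_congr fun y => ?_
      simp
    · intro y hy
      by_cases h : (y : 𝓔) * (u : 𝓔)⁻¹ ∈ E
      · exact ⟨⟨_, h⟩, by ext; simp⟩
      · simp [h] at hy
  rw [h1, act, ← ENNReal.tsum_add]
  refine tsum_congr fun y => ?_
  rw [← add_mul, excessMatrix]
  congr 1
  split_ifs with h
  · refine tsub_add_cancel_of_le ?_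
    have h2 := hB x ⟨(y : 𝓔) * (u : 𝓔)⁻¹, h⟩ u
    have h3 : (⟨(y : 𝓔) * (u : 𝓔)⁻¹, h⟩ : E) * u = y := by ext; simp
    rwa [h3] at h2
  · simp

variable [Countable E]

/-- This presents `p_H f(u)` as the potential part, at `e`, of a Riesz decomposition for `p`. -/
theorem act_ladderMatrix (hp : Substochastic p) (f : E → ℝ≥0∞) (u : E) :
    act (ladderMatrix p hp) f u = ∑' k, (act p)^[k] (act (excessMatrix p u) f) 1 := by
  simp_rw [← tsum_transProb_mul hp]
  rw [ENNReal.tsum_comm]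
  simp_rw [ENNReal.tsum_mul_right]
  simp_rw [act, ladderMatrix, ← ENNReal.tsum_mul_left, ← ENNReal.tsum_mul_right]
  rw [ENNReal.tsum_comm]
  exact tsum_congr fun z => tsum_congr fun y => by
    rw [mul_assoc, green, ENNReal.tsum_mul_right]

/-- A harmonic function of the chain satisfies `h = h(e) + p_H h`. -/
theorem eq_add_act_ladderMatrix (hp : Substochastic p) (hB : TranslationMonotone p)
    (hslow : ∀ u : E, SlowlyVaryingAlong p hp u) {f : E → ℝ≥0∞} (hf : f ∈ harmonicCone p) :
    f = (fun _ => f 1) + act (ladderMatrix p hp) f := by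
  funext u
  have h := riesz (q := p) (g := fun y => f (y * u)) (d := act (excessMatrix p u) f)
    (funext fun z => by
      rw [Pi.add_apply, act_excessMatrix_add hB, hf.2]) 1
  have hT := congrFun (transHarm_eq_self hp hB hslow hf u) 1
  rw [transHarm] at hT
  rw [hT, ← act_ladderMatrix hp, one_mul] at h
  rw [h, add_comm]
  rfl

omit [Countable E] in
theorem const_eq_mul_one (c : ℝ≥0∞) :
    (fun _ : E => c) = fun y => c * (1 : E → ℝ≥0∞) y := by
  simp

/-- Riesz decomposition for `p_H`: the defect of `f` is the constant `f(e)`, whose potential is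
`f(e) V`. -/
theorem eq_mul_tsum_add_iInf (hp : Substochastic p) (hB : TranslationMonotone p)
    (hslow : ∀ u : E, SlowlyVaryingAlong p hp u) {f : E → ℝ≥0∞} (hf : f ∈ harmonicCone p)
    (x : E) :
    f x = f 1 * ∑' k, (act (ladderMatrix p hp))^[k] 1 x
      + ⨅ n, (act (ladderMatrix p hp))^[n] f x := by
  conv_lhs => rw [riesz (eq_add_act_ladderMatrix hp hB hslow hf) x]
  simp_rw [const_eq_mul_one (f 1), act_iterate_smul, ENNReal.tsum_mul_left]

/-- `W_n = ∑_{t < n} p^t 1`, the mean of the absorption time truncated at `n`. -/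
noncomputable def truncTime (p : E → E → ℝ≥0∞) (n : ℕ) (x : E) : ℝ≥0∞ :=
  ∑ t ∈ Finset.range n, (act p)^[t] 1 x

omit [Countable E] in
theorem truncTime_succ (n : ℕ) (x : E) :
    truncTime p (n + 1) x = 1 + act p (truncTime p n) x := by
  have h : act p (truncTime p n) x = ∑ t ∈ Finset.range n, act p ((act p)^[t] 1) x :=
    congrFun (act_sum (q := p) (Finset.range n) fun t => (act p)^[t] 1) x
  rw [h, truncTime, Finset.sum_range_succ', add_comm]
  simp only [Function.iterate_succ_apply']
  rfl

omit [Countable E] in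
theorem iterate_one_le (hp : Substochastic p) (n : ℕ) (x : E) : (act p)^[n] 1 x ≤ 1 :=
  iterate_antitone (act_one_le hp) (Nat.zero_le n) x

omit [Countable E] in
theorem truncTime_le (hp : Substochastic p) (n : ℕ) (x : E) : truncTime p n x ≤ n := by
  refine (Finset.sum_le_sum fun t _ => iterate_one_le hp t x).trans ?_
  simp

/-- A substitute for `h = h(e) + p_H h` that holds for the bounded functions `W_n`. The recursion
`W_{n+1} = 1 + p W_n` is unfolded at `x ⋆ u` and split by the excess matrix; at `x = e` the
accumulated excess is part of `p_H W_n(u)`. -/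
theorem truncTime_le_add_act (hp : Substochastic p) (hB : TranslationMonotone p) (n : ℕ) (u : E) :
    truncTime p n u ≤ truncTime p n 1 + act (ladderMatrix p hp) (truncTime p n) u := by
  have hmono : ∀ n, truncTime p n ≤ truncTime p (n + 1) := fun n x => by
    rw [truncTime, truncTime, Finset.sum_range_succ]
    exact le_self_add
  have key : ∀ n x, truncTime p n (x * u) ≤ truncTime p n x
      + ∑ k ∈ Finset.range n, (act p)^[k] (act (excessMatrix p u) (truncTime p n)) x := by
    intro n
    induction n with
    | zero => intro x; simp [truncTime]
    | succ n ih =>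
      intro x
      set D : ℕ → E → ℝ≥0∞ := fun n => act (excessMatrix p u) (truncTime p n)
      have hD : D n ≤ D (n + 1) := act_mono (hmono n)
      have h1 : act p (fun y => truncTime p n (y * u)) x ≤ act p (truncTime p n) x
          + ∑ k ∈ Finset.range n, (act p)^[k + 1] (D (n + 1)) x := by
        refine (act_mono (g := truncTime p n
          + fun y => ∑ k ∈ Finset.range n, (act p)^[k] (D (n + 1)) y) (fun y => ?_) x).trans ?_
        · refine (ih y).trans ?_
          rw [Pi.add_apply]
          gcongr with k
          exact act_iterate_mono hD k y
        · rw [act_add, act_sum, Pi.add_apply]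
          simp only [Function.iterate_succ_apply']
          exact le_rfl
      rw [truncTime_succ, truncTime_succ, ← act_excessMatrix_add hB, Finset.sum_range_succ']
      calc 1 + (D n x + act p (fun y => truncTime p n (y * u)) x)
          ≤ 1 + (D (n + 1) x + (act p (truncTime p n) x
            + ∑ k ∈ Finset.range n, (act p)^[k + 1] (D (n + 1)) x)) := by
            gcongr
            exact hD x
        _ = _ := by
          rw [Function.iterate_zero, id]
          ring
  have h := key n 1
  rw [one_mul] at h
  refine h.trans ?_
  rw [act_ladderMatrix]
  gcongr
  exact ENNReal.sum_le_tsum _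

/-- If the mean absorption time of the chain is infinite, the renewal function is harmonic. -/
theorem renewal_harmonic (hp : Substochastic p) (hB : TranslationMonotone p)
    (hslow : ∀ u : E, SlowlyVaryingAlong p hp u) {f V : E → ℝ≥0∞} (hf : f ∈ harmonicCone p)
    (hf1 : f 1 ≠ 0) (hV : ∀ x, V x = ∑' k, (act (ladderMatrix p hp))^[k] 1 x)
    (hinf : ∑' k, (act p)^[k] 1 (1 : E) = ∞) : V ∈ harmonicCone p ∧ V 1 = 1 := by
  have hfV : ∀ x, f 1 * V x ≤ f x := fun x => by
    rw [eq_mul_tsum_add_iInf hp hB hslow hf x, hV]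
    exact le_self_add
  have hVfin : ∀ x, V x ≠ ∞ := fun x hx => by
    have h := hfV x
    rw [hx, ENNReal.mul_top hf1, top_le_iff] at h
    exact hf.1 x h
  have hVact : ∀ x, act p V x ≠ ∞ := fun x hx => by
    have h := act_mono (q := p) hfV x
    rw [act_smul, hf.2] at h
    beta_reduce at h
    rw [hx, ENNReal.mul_top hf1, top_le_iff] at h
    exact hf.1 x h
  have hWfin : ∀ n x, truncTime p n x ≠ ∞ := fun n x =>
    ne_top_of_le_ne_top (ENNReal.natCast_ne_top n) (truncTime_le hp n x)
  have hW0 : ∀ n, truncTime p (n + 1) 1 ≠ 0 := fun n => by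
    rw [truncTime_succ]
    simp
  set g : ℕ → E → ℝ≥0∞ := fun n x => (truncTime p (n + 1) 1)⁻¹ * truncTime p (n + 1) x with hg
  have hgV : ∀ n, g n ≤ V := by
    intro n x
    have h := le_tsum_iterate (q := ladderMatrix p hp) (g := truncTime p (n + 1))
      (c := (truncTime p (n + 1) 1).toNNReal) (M := (n + 1 : ℕ))
      (fun x => by
        rw [ENNReal.coe_toNNReal (hWfin _ _)]
        exact truncTime_le_add_act hp hB _ x)
      (fun x => by simpa using truncTime_le hp (n + 1) x)
      (fun x => by rw [← hV]; exact hVfin x) x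
    rw [ENNReal.coe_toNNReal (hWfin _ _), ← hV] at h
    exact (ENNReal.inv_mul_le_iff (hW0 n) (hWfin _ _)).2 h
  -- Compactness of `[0, ∞]` gives pointwise limits at all states simultaneously along one
  -- ultrafilter.
  set U : Ultrafilter ℕ := hyperfilter ℕ with hU
  have hUle : (U : Filter ℕ) ≤ atTop := Nat.hyperfilter_le_atTop
  have hlim : ∀ x, ∃ a, Tendsto (fun n => g n x) U (𝓝 a) := fun x =>
    ⟨_, (U.map fun n => g n x).le_nhds_lim⟩
  choose v hv using hlim
  have hvV : v ≤ V := fun x => le_of_tendsto' (hv x) fun n => hgV n x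
  have hinv : Tendsto (fun n => (truncTime p (n + 1) 1)⁻¹) U (𝓝 0) := by
    have h := ENNReal.tendsto_nat_tsum fun k => (act p)^[k] 1 (1 : E)
    rw [hinf] at h
    have h2 := ((tendsto_add_atTop_iff_nat 1).2 h).mono_left hUle
    exact ENNReal.inv_top ▸ tendsto_inv_iff.2 h2
  -- After normalisation, `W_{n+1} + p^{n+1} 1 = 1 + p W_{n+1}`. Both `1` and `p^{n+1} 1` disappear
  -- in the limit because `W_n(e) → ∞`.
  have hvact : act p v = v := by
    funext x
    have h1 := (tendsto_act hp hgV hvV hv (hVact x)).add hinv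
    have h2 : Tendsto (fun n => (truncTime p (n + 1) 1)⁻¹ * (act p)^[n + 1] 1 x) U (𝓝 0) :=
      tendsto_of_tendsto_of_tendsto_of_le_of_le tendsto_const_nhds hinv (fun _ => zero_le)
        fun n => mul_le_of_le_one_right' (iterate_one_le hp _ x)
    have h3 := (hv x).add h2
    rw [add_zero] at h1 h3
    refine tendsto_nhds_unique h1 (h3.congr fun n => ?_)
    have h4 := truncTime_succ (p := p) (n + 1) x
    rw [truncTime, Finset.sum_range_succ] at h4
    change truncTime p (n + 1) x + _ = _ at h4
    simp only [hg]
    rw [← mul_add, h4, mul_add, mul_one, add_comm, act_smul]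
  have hv1 : v 1 = 1 := by
    refine tendsto_nhds_unique (hv 1) (tendsto_const_nhds.congr fun n => ?_)
    exact (ENNReal.inv_mul_cancel (hW0 n) (hWfin _ _)).symm
  have hvmem : v ∈ harmonicCone p :=
    ⟨fun x => ne_top_of_le_ne_top (hVfin x) (hvV x), hvact⟩
  -- The decomposition of `v` itself, with `v(e) = 1`, gives `v ≥ V`.
  have hvV' : v = V := by
    refine le_antisymm hvV fun x => ?_
    rw [eq_mul_tsum_add_iInf hp hB hslow hvmem x, hv1, one_mul, ← hV]
    exact le_self_add
  exact hvV' ▸ ⟨hvmem, hv1⟩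

/-- The renewal function is dominated by the mean absorption time, if the latter is finite. -/
theorem renewal_le_tsum (hp : Substochastic p) (hB : TranslationMonotone p) (x : E) :
    ∑' k, (act (ladderMatrix p hp))^[k] 1 x ≤ ∑' k, (act p)^[k] 1 x := by
  set W : E → ℝ≥0∞ := fun x => ∑' k, (act p)^[k] 1 x with hW
  have hWeq : ∀ x, W x = 1 + act p W x := congrFun (tsum_iterate_eq 1)
  refine tsum_iterate_le (g := W) (fun u => ?_) x
  -- The translate of `W` has defect `1 + a_u W`, whose potential at `e` is `W(e) + p_H W(u)`. Since
  -- `W(e) ≥ 1`, this gives `1 + p_H W ≤ W`.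
  have h := tsum_iterate_le (q := p) (g := fun y => W (y * u))
    (d := 1 + act (excessMatrix p u) W) (fun z => by
      rw [Pi.add_apply, Pi.add_apply, add_assoc, act_excessMatrix_add hB]
      exact (hWeq (z * u)).ge) 1
  simp only [act_iterate_add, Pi.add_apply] at h
  rw [ENNReal.tsum_add, one_mul, ← act_ladderMatrix hp] at h
  refine le_trans ?_ h
  rw [Pi.add_apply]
  gcongr
  change 1 ≤ W 1
  rw [hWeq]
  exact le_self_add

end Ladder

end LadderWalk

/-! ### The decomposition and the dichotomy for the mean exit time -/

theorem theorem3 {𝓔 : Type*} [Group 𝓔] (E : Submonoid 𝓔) [Countable E]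
    (p : E → E → ℝ≥0∞) (hp : LadderWalk.Substochastic p)
    (hirr : LadderWalk.IsIrreducibleChain p hp) (htrans : LadderWalk.IsTransientChain p hp)
    (hB : LadderWalk.TranslationMonotone p)
    (hslow : ∀ u : E, LadderWalk.SlowlyVaryingAlong p hp u)
    (h : E → ℝ≥0) (hharm : LadderWalk.IsHarmonic p h) :
    LadderWalk.IsSuperharmonic (LadderWalk.ladderMatrix p hp) h ∧
    ∃ h' : E → ℝ≥0,
      (∀ x, Tendsto
        (fun n : ℕ => LadderWalk.killedMean (LadderWalk.ladderMatrix p hp)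
          (LadderWalk.ladderMatrix_substochastic p hp hB) h n x)
        atTop (𝓝 (h' x : ℝ≥0∞))) ∧
      (∀ x, LadderWalk.applyMatrix (LadderWalk.ladderMatrix p hp) h' x = h' x) ∧
      (∀ x, LadderWalk.renewalFunction p hp hB x < ∞ ∧
        (h x : ℝ≥0∞) = (h 1 : ℝ≥0∞) * LadderWalk.renewalFunction p hp hB x + (h' x : ℝ≥0∞)) ∧
      ((∀ x, LadderWalk.meanExitTime p hp x = ∞) →
        h' = 0 ∧ ∃ c : ℝ≥0, 0 < c ∧
          ∀ x, (h x : ℝ≥0∞) = (c : ℝ≥0∞) * LadderWalk.renewalFunction p hp hB x) ∧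
      ((¬ ∀ x, LadderWalk.meanExitTime p hp x = ∞) → h' ≠ 0) := by
  open LadderWalk in
  have hL := ladderMatrix_substochastic p hp hB
  set L := ladderMatrix p hp with hLdef
  set H : E → ℝ≥0∞ := fun x => (h x : ℝ≥0∞) with hH
  have hHmem : H ∈ harmonicCone p := ⟨fun x => ENNReal.coe_ne_top, funext hharm.2⟩
  have hHeq : H = (fun _ => H 1) + act L H := eq_add_act_ladderMatrix hp hB hslow hHmem
  have hHle : act L H ≤ H := act_le_of_eq_add hHeq
  have hV : ∀ x, renewalFunction p hp hB x = ∑' k, (act L)^[k] 1 x := fun x =>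
    meanAbsorptionTime_eq _ (Nat.zero_le 1) x
  have hexit : ∀ x, meanExitTime p hp x = ∑' k, (act p)^[k] 1 x := fun x =>
    meanAbsorptionTime_eq _ le_rfl x
  have hpos : ∀ f ∈ harmonicCone p, ∀ x y, f x = 0 → f y = 0 := by
    intro f hf x y hx
    obtain ⟨t, ht⟩ := hirr x y
    have h1 := transProb_mul_le hp hf.2.le t x y
    rw [hx, nonpos_iff_eq_zero, mul_eq_zero] at h1
    exact h1.resolve_left ht.ne'
  have hH1 : H 1 ≠ 0 := fun h0 => hharm.1 (funext fun y => by
    simpa [hH] using hpos H hHmem 1 y h0)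
  have hdec : ∀ x, H x = H 1 * renewalFunction p hp hB x + ⨅ n, (act L)^[n] H x := fun x => by
    rw [hV]
    exact eq_mul_tsum_add_iInf hp hB hslow hHmem x
  set I : E → ℝ≥0∞ := fun x => ⨅ n, (act L)^[n] H x with hI
  have hIfin : ∀ x, I x ≠ ∞ := fun x =>
    ne_top_of_le_ne_top (hHmem.1 x) (iInf_le (fun n => (act L)^[n] H x) 0)
  have hIcoe : (fun x => ((I x).toNNReal : ℝ≥0∞)) = I := funext fun x =>
    ENNReal.coe_toNNReal (hIfin x)
  have hVfin : ∀ x, renewalFunction p hp hB x ≠ ∞ := fun x hx => by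
    have h1 := hdec x
    rw [hx, ENNReal.mul_top hH1, top_add] at h1
    exact hHmem.1 x h1
  refine ⟨⟨hharm.1, hHle⟩, fun x => (I x).toNNReal, fun x => ?_, fun x => ?_, fun x => ⟨?_, ?_⟩,
    fun hinf => ?_, fun hfin h0 => ?_⟩
  · simp only [killedMean_eq]
    rw [congrFun hIcoe x]
    exact tendsto_atTop_iInf fun _ _ hmn => iterate_antitone hHle hmn x
  · have h1 := congrFun (act_iInf_iterate hL hHle hHmem.1) x
    change act L (fun x => ((I x).toNNReal : ℝ≥0∞)) x = _
    rw [hIcoe, congrFun hIcoe x]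
    exact h1
  · exact (hVfin x).lt_top
  · rw [congrFun hIcoe x]
    exact hdec x
  · obtain ⟨hVmem, hV1⟩ := renewal_harmonic hp hB hslow hHmem hH1 hV ((hexit 1).symm.trans (hinf 1))
    have hsub : I = H - fun x => (h 1 : ℝ≥0∞) * renewalFunction p hp hB x := by
      funext x
      rw [Pi.sub_apply, hdec x, ENNReal.add_sub_cancel_left
        (ENNReal.mul_ne_top ENNReal.coe_ne_top (hVfin x))]
    have hImem : I ∈ harmonicCone p := by
      rw [hsub]
      refine sub_mem_harmonicCone hHmem (smul_mem_harmonicCone _ hVmem) fun x => ?_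
      rw [hdec x]
      exact le_self_add
    have hI1 : I 1 = 0 := by
      rw [hsub, Pi.sub_apply, hV1, mul_one]
      exact tsub_self _
    have hI0 : ∀ x, I x = 0 := fun x => hpos I hImem 1 x hI1
    refine ⟨funext fun x => by simp [hI0], h 1, pos_iff_ne_zero.2 fun h0 => hH1 (by simp [hH, h0]),
      fun x => ?_⟩
    have h1 := hdec x
    change H x = _ + I x at h1
    rwa [hI0, add_zero] at h1
  · have hI0 : ∀ x, I x = 0 := fun x => by
      rw [← congrFun hIcoe x, ENNReal.coe_eq_zero]
      exact congrFun h0 x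
    push Not at hfin
    obtain ⟨a, ha⟩ := hfin
    rw [hexit] at ha
    set W : E → ℝ≥0∞ := fun x => ∑' k, (act p)^[k] 1 x with hW
    have hWeq : W = 1 + act p W := tsum_iterate_eq 1
    have hWle : act p W ≤ W := act_le_of_eq_add hWeq
    -- Finiteness is known only at `a`; irreducibility carries it to the identity, as `W` is
    -- superharmonic.
    have hWfin : W 1 ≠ ∞ := fun h1 => by
      obtain ⟨t, ht⟩ := hirr a 1
      have h2 := transProb_mul_le hp hWle t a 1
      rw [h1, ENNReal.mul_top ht.ne', top_le_iff] at h2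
      exact ha h2
    -- `W` is the potential of `1`, so its Riesz decomposition has no harmonic part where it is
    -- finite.
    have hW0 : ⨅ n, (act p)^[n] W 1 = 0 := by
      have h1 := riesz hWeq 1
      have h2 : W 1 + 0 = W 1 + ⨅ n, (act p)^[n] W 1 := by rw [add_zero]; exact h1
      exact ((ENNReal.add_right_inj hWfin).1 h2).symm
    have hHW : H ≤ fun x => (h 1 : ℝ≥0∞) * W x := fun x => by
      have h1 := hdec x
      change H x = _ + I x at h1
      rw [hI0, add_zero, hV] at h1
      rw [h1]
      exact mul_le_mul_right (renewal_le_tsum hp hB x) _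
    refine hH1 (nonpos_iff_eq_zero.1 ?_)
    have h1 : H 1 ≤ ⨅ n, (h 1 : ℝ≥0∞) * (act p)^[n] W 1 := le_iInf fun n => by
      have h2 := act_iterate_mono (q := p) hHW n 1
      rwa [iterate_eq_self hHmem.2, act_iterate_smul] at h2
    rwa [← ENNReal.mul_iInf fun h => absurd h ENNReal.coe_ne_top, hW0, mul_zero] at h1
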